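/- Let $A_0,A_1,C_0,C_1\in\mathbb C$. For functions $u^\pm,v,w$ of one complex variable and functions $R,T$ of $(x,y)\in\mathbb C^2$ put $\partial_x=\partial/\partial x$, $\partial_y=\partial/\partial y$ and $$P=-\tfrac12(\partial_x^2+\partial_y^2)+R(x,y),$$ $$P_2=\bigl(\partial_x\partial_y+u^-(x-y)-u^+(x+y)\bigr)^2-2w(y)\partial_x^2-2v(x)\partial_y^2+4v(x)w(y)+T(x,y).\qquad(\ast)$$ For a pair of $\mathbb R$-linearly independent complex numbers $a,b$ let $\wp(z;a,b)$ be the Weierstrass function with period lattice $\mathbb Za+\mathbb Zb$, and write $\sinh^{-2}z=1/(\sinh z)^2$, $\cosh^{-2}z=1/(\cosh z)^2$. **Theorem ($B_2$: special case).** For each of the following eight families, let $\Omega\subset\mathbb C^2$ be the open set indicated, on which all the functions that occur are holomorphic. Then on $\Omega$ one has $R(x,y)=u^+(x+y)+u^-(x-y)+v(x)+w(y)$; the operator $P_2$ given by $(\ast)$ is of the form $P_2=\partial_x^2\partial_y^2+S$ with $S$ a differential operator of order $<4$ with coefficients holomorphic on $\Omega$; and $$[P,P_2]=0,$$ that is,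 $PP_2f=P_2Pf$ for every holomorphic function $f$ on an open subset of $\Omega$. Here $\lambda\in\mathbb C$ is arbitrary (with $\Omega$ empty, so that nothing is claimed, if $\lambda=0$ in a family in which $\sinh^{-2}$ occurs). 1. (Ellip-$B_2$-S) $\omega_1,\omega_2\in\mathbb C$ are linearly independent over $\mathbb R$, $\omega_0=0$, $\omega_3=-\omega_1-\omega_2$; $u^\pm(t)=A_0\wp(t;2\omega_1,2\omega_2)+A_1\wp(t;\omega_1,2\omega_2)$, $v(t)=w(t)=C_0\wp(t;\omega_1,2\omega_2)+C_1\wp(t;\omega_1,\omega_2)$, $R=u^-(x-y)+u^+(x+y)+v(x)+w(y)$, $$\begin{aligned}T={}&2\bigl(u^-(x-y)+u^+(x+y)\bigr)\bigl(v(x)+w(y)\bigr)-4A_0C_0\sum_{j=0}^1\wp(x+\omega_j;2\omega_1,2\omega_2)\wp(y+\omega_j;2\omega_1,2\omega_2)\\&-4A_0C_1\sum_{j=0}^3\wp(x+\omega_j;2\omega_1,2\omega_2)\wp(y+\omega_j;2\omega_1,2\omega_2)-4A_1C_0\,\wp(x;\omega_1,2\omega_2)\wp(y;\omega_1,2\omega_2)\\&-4A_1C_1\sum_{j=0}^1\wp(x+\omega_{2j};\omega_1,2\omega_2)\wp(y+\omega_{2j};\omega_1,2\omega_2);\end{aligned}$$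 $\Omega$: $x\pm y\notin\mathbb Z\omega_1+2\mathbb Z\omega_2$ and $x,y\notin\mathbb Z\omega_1+\mathbb Z\omega_2$. 2. (Trig-$B_2$-S) $u^\pm(t)=A_0\sinh^{-2}\lambda t+A_1\sinh^{-2}2\lambda t$, $v(t)=w(t)=C_0\sinh^{-2}2\lambda t+C_1\sinh^22\lambda t$, $R=u^-(x-y)+u^+(x+y)+v(x)+w(y)$, $$\begin{aligned}T={}&2\bigl(u^-(x-y)+u^+(x+y)\bigr)\bigl(v(x)+w(y)\bigr)-A_0C_0\bigl(\sinh^{-2}\lambda x\,\sinh^{-2}\lambda y+\cosh^{-2}\lambda x\,\cosh^{-2}\lambda y\bigr)\\&-16A_0C_1\bigl(\sinh^2\lambda x+\sinh^2\lambda y+2\sinh^2\lambda x\,\sinh^2\lambda y\bigr)-4A_1C_0\sinh^{-2}2\lambda x\,\sinh^{-2}2\lambda y;\end{aligned}$$ $\Omega$: $\sinh2\lambda(x\pm y)$, $\sinh2\lambda x$, $\sinh2\lambda y$ are all nonzero. 3. (Rat-$B_2$-S) $u^\pm(t)=A_0t^{-2}+A_1t^2$, $v(t)=w(t)=C_0t^{-2}+C_1t^2$,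 $R=u^-(x-y)+u^+(x+y)+v(x)+w(y)$, $$T=\frac{16A_0C_0+16A_0C_1x^2y^2}{(x^2-y^2)^2}+16A_1C_1x^2y^2;$$ $\Omega$: $x\ne\pm y$, $x\neq0$, $y\neq0$. 4. (Toda-$D_2^{(1)}$-S-bry) $u^\pm(t)=A_0\cosh2\lambda t+A_1\cosh4\lambda t$, $v(t)=C_0\sinh^{-2}2\lambda t$, $w(t)=C_1\sinh^{-2}2\lambda t$, $R=u^-(x-y)+u^+(x+y)+v(x)+w(y)$, $T=8A_1(C_0\cosh4\lambda y+C_1\cosh4\lambda x)$; $\Omega$: $\sinh2\lambda x$ and $\sinh2\lambda y$ are nonzero. 5. (Toda-$B_2^{(1)}$-S-bry) $u^\pm(t)=A_0e^{-2\lambda t}+A_1e^{-4\lambda t}$, $v(t)=C_0e^{4\lambda t}$, $w(t)=C_1\sinh^{-2}2\lambda t$, $R=u^-(x-y)+u^+(x+y)+v(x)+w(y)$, $T=4A_1(C_0\cosh4\lambda y+2C_1e^{-4\lambda x})$; $\Omega$: $\sinh2\lambda y\ne0$. 6. (Toda-$C_2^{(1)}$-S) $u^-(t)=A_0e^{-2\lambda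 t}+A_1e^{-4\lambda t}$, $u^+(t)=0$, $v(t)=C_0e^{4\lambda t}$, $w(t)=C_1e^{-4\lambda t}$, $R=u^-(x-y)+v(x)+w(y)$, $T=2A_1(C_0e^{4\lambda y}+C_1e^{-4\lambda x})$; $\Omega=\mathbb C^2$. 7. (Trig-$A_1$-S-bry) $u^-(t)=A_0\sinh^{-2}\lambda t+A_1\sinh^{-2}2\lambda t$, $u^+(t)=0$, $v(t)=w(t)=C_0e^{-4\lambda t}+C_1e^{4\lambda t}$, $R=u^-(x-y)+v(x)+w(y)$, $$T=2A_1\sinh^{-2}2\lambda(x-y)\bigl(v(x)+w(y)\bigr)+4A_0\sinh^{-2}\lambda(x-y)\bigl(C_0e^{-2\lambda(x+y)}+C_1e^{2\lambda(x+y)}\bigr);$$ $\Omega$: $\sinh2\lambda(x-y)\neq0$. 8. (Rat$^d$-$D_2$-S-bry) $u^\pm(t)=A_0t^2+A_1t^4$, $v(t)=C_0t^{-2}$, $w(t)=C_1t^{-2}$, $R=2A_0(x^2+y^2)+2A_1(x^4+6x^2y^2+y^4)+C_0x^{-2}+C_1y^{-2}$, $T=32A_1(C_0y^2+C_1x^2)$;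 $\Omega$: $x\neq0$, $y\neq0$. -/

import Mathlib

noncomputable section

namespace TypeB2

/-! ### Partial differential operators in two complex variables -/

/-- The partial derivative `∂/∂x` of a function of `(x, y) ∈ ℂ²`. -/
def dX (f : ℂ × ℂ → ℂ) : ℂ × ℂ → ℂ :=
  fun p => deriv (fun s => f (s, p.2)) p.1

/-- The partial derivative `∂/∂y` of a function of `(x, y) ∈ ℂ²`. -/
def dY (f : ℂ × ℂ → ℂ) : ℂ × ℂ → ℂ :=
  fun p => deriv (fun s => f (p.1, s)) p.2

/-- `[A, B] = 0` on `Ω`: the two operators commute on every holomorphic function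
on every open subset of `Ω`. -/
def CommuteOn (Ω : Set (ℂ × ℂ)) (A B : (ℂ × ℂ → ℂ) → (ℂ × ℂ → ℂ)) : Prop :=
  ∀ U : Set (ℂ × ℂ), IsOpen U → U ⊆ Ω → ∀ f : ℂ × ℂ → ℂ, AnalyticOnNhd ℂ f U →
    ∀ p ∈ U, A (B f) p = B (A f) p

/-- On `Ω` the operator `A` is the differential operator
`∑_{i + j < n} a i j ∂ₓ^i ∂ᵧ^j` with coefficients `a i j` holomorphic on `Ω`. -/
def IsDiffOpOfOrderLT (n : ℕ) (Ω : Set (ℂ × ℂ)) (A : (ℂ × ℂ → ℂ) → (ℂ × ℂ → ℂ)) : Prop :=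
  ∃ a : ℕ → ℕ → ℂ × ℂ → ℂ, (∀ i j, AnalyticOnNhd ℂ (a i j) Ω) ∧
    ∀ U : Set (ℂ × ℂ), IsOpen U → U ⊆ Ω → ∀ f : ℂ × ℂ → ℂ, AnalyticOnNhd ℂ f U →
      ∀ p ∈ U, A f p =
        ∑ i ∈ Finset.range n, ∑ j ∈ Finset.range (n - i), a i j p * dX^[i] (dY^[j] f) p

/-! ### The operators `P` and `P₂` -/

/-- The functions from which the operators `P` and `P₂` are made, together with the set `Ω`
of points of `ℂ²` at which the operators are considered (for each of the systems below, the
complement of the singularities of the functions that occur). -/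
structure System where
  /-- The set where the coefficients are regular. -/
  Ω : Set (ℂ × ℂ)
  /-- The function `u⁻`. -/
  uM : ℂ → ℂ
  /-- The function `u⁺`. -/
  uP : ℂ → ℂ
  /-- The function `v`. -/
  v : ℂ → ℂ
  /-- The function `w`. -/
  w : ℂ → ℂ
  /-- The potential `R(x, y)`. -/
  R : ℂ → ℂ → ℂ
  /-- The function `T(x, y)`. -/
  T : ℂ → ℂ → ℂ

namespace System

/-- `P = -1/2 (∂ₓ² + ∂ᵧ²) + R(x, y)`. -/
def P (s : System) (f : ℂ × ℂ → ℂ) : ℂ × ℂ → ℂ :=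
  fun p => -(1 / 2) * (dX (dX f) p + dY (dY f) p) + s.R p.1 p.2 * f p

/-- `D = ∂ₓ∂ᵧ + u⁻(x - y) - u⁺(x + y)`. -/
def D (s : System) (f : ℂ × ℂ → ℂ) : ℂ × ℂ → ℂ :=
  fun p => dX (dY f) p + (s.uM (p.1 - p.2) - s.uP (p.1 + p.2)) * f p

/-- `P₂ = (∂ₓ∂ᵧ + u⁻(x - y) - u⁺(x + y))² - 2 w(y) ∂ₓ² - 2 v(x) ∂ᵧ² + 4 v(x) w(y) + T(x, y)`. -/
def P₂ (s : System) (f : ℂ × ℂ → ℂ) : ℂ × ℂ → ℂ :=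
  fun p => s.D (s.D f) p - 2 * s.w p.2 * dX (dX f) p - 2 * s.v p.1 * dY (dY f) p
    + (4 * s.v p.1 * s.w p.2 + s.T p.1 p.2) * f p

/-- The potential has the form `R = u⁺(x + y) + u⁻(x - y) + v(x) + w(y)`, it is holomorphic on
the open set `Ω`, the operator `P₂` equals `∂ₓ²∂ᵧ² + S` with `ord S < 4`, and `[P, P₂] = 0`. -/
structure IsCommuting (s : System) : Prop where
  isOpen : IsOpen s.Ω
  potential : ∀ x y, (x, y) ∈ s.Ω → s.R x y = s.uP (x + y) + s.uM (x - y) + s.v x + s.w y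
  analytic : AnalyticOnNhd ℂ (fun p : ℂ × ℂ => s.R p.1 p.2) s.Ω
  order : IsDiffOpOfOrderLT 4 s.Ω (fun f p => s.P₂ f p - dX^[2] (dY^[2] f) p)
  commute : CommuteOn s.Ω s.P s.P₂

end System

/-! ### Elliptic, hyperbolic and trigonometric functions -/

/-- The pair of periods `(m ω₁, n ω₂)`, for nonzero natural numbers `m` and `n`. -/
def scale (L : PeriodPair) (m n : ℕ) (hm : m ≠ 0) (hn : n ≠ 0) : PeriodPair where
  ω₁ := m * L.ω₁
  ω₂ := n * L.ω₂
  indep := by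
    have h := LinearIndependent.pair_iff.mp L.indep
    refine LinearIndependent.pair_iff.mpr fun s t hst => ?_
    have h' := h (s * m) (t * n) (by
      simp only [Complex.real_smul] at hst ⊢
      push_cast
      linear_combination hst)
    simpa [hm, hn] using h'

/-- `℘(z; 2ω₁, 2ω₂)`. -/
def wp22 (L : PeriodPair) : ℂ → ℂ :=
  (scale L 2 2 two_ne_zero two_ne_zero).weierstrassP

/-- `℘(z; ω₁, 2ω₂)`. -/
def wp12 (L : PeriodPair) : ℂ → ℂ :=
  (scale L 1 2 one_ne_zero two_ne_zero).weierstrassP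

/-- `℘(z; ω₁, ω₂)`. -/
def wp11 (L : PeriodPair) : ℂ → ℂ :=
  L.weierstrassP

/-- `ω_0 = 0`, `ω_1`, `ω_2` and `ω_3 = -ω_1 - ω_2`. -/
def om (L : PeriodPair) : Fin 4 → ℂ :=
  ![0, L.ω₁, L.ω₂, -L.ω₁ - L.ω₂]

/-- `sinh⁻² z = 1 / (sinh z)²`. -/
def sinhInvSq (z : ℂ) : ℂ := (Complex.sinh z ^ 2)⁻¹

/-- `cosh⁻² z = 1 / (cosh z)²`. -/
def coshInvSq (z : ℂ) : ℂ := (Complex.cosh z ^ 2)⁻¹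

/-! ### The eight special systems -/

open Complex

/-- (Ellip-B₂-S) -/
def ellipB2S (L : PeriodPair) (A₀ A₁ C₀ C₁ : ℂ) : System where
  Ω := {p | p.1 - p.2 ∉ (scale L 1 2 one_ne_zero two_ne_zero).lattice ∧
            p.1 + p.2 ∉ (scale L 1 2 one_ne_zero two_ne_zero).lattice ∧
            p.1 ∉ L.lattice ∧ p.2 ∉ L.lattice}
  uM t := A₀ * wp22 L t + A₁ * wp12 L t
  uP t := A₀ * wp22 L t + A₁ * wp12 L t
  v t := C₀ * wp12 L t + C₁ * wp11 L t
  w t := C₀ * wp12 L t + C₁ * wp11 L t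
  R x y := A₀ * wp22 L (x - y) + A₀ * wp22 L (x + y)
    + A₁ * wp12 L (x - y) + A₁ * wp12 L (x + y)
    + C₀ * wp12 L x + C₀ * wp12 L y + C₁ * wp11 L x + C₁ * wp11 L y
  T x y := 2 * (A₀ * wp22 L (x - y) + A₀ * wp22 L (x + y)
      + A₁ * wp12 L (x - y) + A₁ * wp12 L (x + y))
      * (C₀ * wp12 L x + C₀ * wp12 L y + C₁ * wp11 L x + C₁ * wp11 L y)
    - 4 * A₀ * C₀ * (wp22 L (x + om L 0) * wp22 L (y + om L 0)
      + wp22 L (x + om L 1) * wp22 L (y + om L 1))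
    - 4 * A₀ * C₁ * ∑ j : Fin 4, wp22 L (x + om L j) * wp22 L (y + om L j)
    - 4 * A₁ * C₀ * (wp12 L x * wp12 L y)
    - 4 * A₁ * C₁ * (wp12 L (x + om L 0) * wp12 L (y + om L 0)
      + wp12 L (x + om L 2) * wp12 L (y + om L 2))

/-- (Trig-B₂-S) -/
def trigB2S (lam A₀ A₁ C₀ C₁ : ℂ) : System where
  Ω := {p | sinh (2 * lam * (p.1 - p.2)) ≠ 0 ∧ sinh (2 * lam * (p.1 + p.2)) ≠ 0 ∧
            sinh (2 * lam * p.1) ≠ 0 ∧ sinh (2 * lam * p.2) ≠ 0}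
  uM t := A₀ * sinhInvSq (lam * t) + A₁ * sinhInvSq (2 * lam * t)
  uP t := A₀ * sinhInvSq (lam * t) + A₁ * sinhInvSq (2 * lam * t)
  v t := C₀ * sinhInvSq (2 * lam * t) + C₁ * sinh (2 * lam * t) ^ 2
  w t := C₀ * sinhInvSq (2 * lam * t) + C₁ * sinh (2 * lam * t) ^ 2
  R x y := A₀ * sinhInvSq (lam * (x + y)) + A₀ * sinhInvSq (lam * (x - y))
    + A₁ * sinhInvSq (2 * lam * (x + y)) + A₁ * sinhInvSq (2 * lam * (x - y))
    + C₀ * sinhInvSq (2 * lam * x) + C₀ * sinhInvSq (2 * lam * y)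
    + C₁ * sinh (2 * lam * x) ^ 2 + C₁ * sinh (2 * lam * y) ^ 2
  T x y := 2 * (A₀ * sinhInvSq (lam * (x + y)) + A₀ * sinhInvSq (lam * (x - y))
      + A₁ * sinhInvSq (2 * lam * (x + y)) + A₁ * sinhInvSq (2 * lam * (x - y)))
      * (C₀ * sinhInvSq (2 * lam * x) + C₀ * sinhInvSq (2 * lam * y)
        + C₁ * sinh (2 * lam * x) ^ 2 + C₁ * sinh (2 * lam * y) ^ 2)
    - A₀ * C₀ * (sinhInvSq (lam * x) * sinhInvSq (lam * y)
      + coshInvSq (lam * x) * coshInvSq (lam * y))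
    - 16 * A₀ * C₁ * (sinh (lam * x) ^ 2 + sinh (lam * y) ^ 2
      + 2 * (sinh (lam * x) ^ 2 * sinh (lam * y) ^ 2))
    - 4 * A₁ * C₀ * (sinhInvSq (2 * lam * x) * sinhInvSq (2 * lam * y))

/-- (Rat-B₂-S) -/
def ratB2S (A₀ A₁ C₀ C₁ : ℂ) : System where
  Ω := {p | p.1 - p.2 ≠ 0 ∧ p.1 + p.2 ≠ 0 ∧ p.1 ≠ 0 ∧ p.2 ≠ 0}
  uM t := A₀ / t ^ 2 + A₁ * t ^ 2
  uP t := A₀ / t ^ 2 + A₁ * t ^ 2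
  v t := C₀ / t ^ 2 + C₁ * t ^ 2
  w t := C₀ / t ^ 2 + C₁ * t ^ 2
  R x y := A₀ / (x - y) ^ 2 + A₀ / (x + y) ^ 2 + A₁ * (x - y) ^ 2 + A₁ * (x + y) ^ 2
    + C₀ / x ^ 2 + C₀ / y ^ 2 + C₁ * x ^ 2 + C₁ * y ^ 2
  T x y := (16 * A₀ * C₀ + 16 * A₀ * C₁ * x ^ 2 * y ^ 2) / (x ^ 2 - y ^ 2) ^ 2
    + 16 * A₁ * C₁ * x ^ 2 * y ^ 2

/-- (Toda-D₂⁽¹⁾-S-bry) -/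
def todaD2SBry (lam A₀ A₁ C₀ C₁ : ℂ) : System where
  Ω := {p | sinh (2 * lam * p.1) ≠ 0 ∧ sinh (2 * lam * p.2) ≠ 0}
  uM t := A₀ * cosh (2 * lam * t) + A₁ * cosh (4 * lam * t)
  uP t := A₀ * cosh (2 * lam * t) + A₁ * cosh (4 * lam * t)
  v t := C₀ * sinhInvSq (2 * lam * t)
  w t := C₁ * sinhInvSq (2 * lam * t)
  R x y := A₀ * cosh (2 * lam * (x - y)) + A₀ * cosh (2 * lam * (x + y))
    + A₁ * cosh (4 * lam * (x - y)) + A₁ * cosh (4 * lam * (x + y))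
    + C₀ * sinhInvSq (2 * lam * x) + C₁ * sinhInvSq (2 * lam * y)
  T x y := 8 * A₁ * (C₀ * cosh (4 * lam * y) + C₁ * cosh (4 * lam * x))

/-- (Toda-B₂⁽¹⁾-S-bry) -/
def todaB2SBry (lam A₀ A₁ C₀ C₁ : ℂ) : System where
  Ω := {p | sinh (2 * lam * p.2) ≠ 0}
  uM t := A₀ * exp (-2 * lam * t) + A₁ * exp (-4 * lam * t)
  uP t := A₀ * exp (-2 * lam * t) + A₁ * exp (-4 * lam * t)
  v t := C₀ * exp (4 * lam * t)
  w t := C₁ * sinhInvSq (2 * lam * t)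
  R x y := A₀ * exp (-2 * lam * (x - y)) + A₀ * exp (-2 * lam * (x + y))
    + A₁ * exp (-4 * lam * (x - y)) + A₁ * exp (-4 * lam * (x + y))
    + C₀ * exp (4 * lam * x) + C₁ * sinhInvSq (2 * lam * y)
  T x y := 4 * A₁ * (C₀ * cosh (4 * lam * y) + 2 * C₁ * exp (-4 * lam * x))

/-- (Toda-C₂⁽¹⁾-S) -/
def todaC2S (lam A₀ A₁ C₀ C₁ : ℂ) : System where
  Ω := Set.univ
  uM t := A₀ * exp (-2 * lam * t) + A₁ * exp (-4 * lam * t)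
  uP _ := 0
  v t := C₀ * exp (4 * lam * t)
  w t := C₁ * exp (-4 * lam * t)
  R x y := A₀ * exp (-2 * lam * (x - y)) + A₁ * exp (-4 * lam * (x - y))
    + C₀ * exp (4 * lam * x) + C₁ * exp (-4 * lam * y)
  T x y := 2 * A₁ * (C₀ * exp (4 * lam * y) + C₁ * exp (-4 * lam * x))

/-- (Trig-A₁-S-bry) -/
def trigA1SBry (lam A₀ A₁ C₀ C₁ : ℂ) : System where
  Ω := {p | sinh (2 * lam * (p.1 - p.2)) ≠ 0}
  uM t := A₀ * sinhInvSq (lam * t) + A₁ * sinhInvSq (2 * lam * t)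
  uP _ := 0
  v t := C₀ * exp (-4 * lam * t) + C₁ * exp (4 * lam * t)
  w t := C₀ * exp (-4 * lam * t) + C₁ * exp (4 * lam * t)
  R x y := A₀ * sinhInvSq (lam * (x - y)) + A₁ * sinhInvSq (2 * lam * (x - y))
    + C₀ * exp (-4 * lam * x) + C₀ * exp (-4 * lam * y)
    + C₁ * exp (4 * lam * x) + C₁ * exp (4 * lam * y)
  T x y := 2 * A₁ * sinhInvSq (2 * lam * (x - y))
      * (C₀ * exp (-4 * lam * x) + C₀ * exp (-4 * lam * y)
        + C₁ * exp (4 * lam * x) + C₁ * exp (4 * lam * y))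
    + 4 * A₀ * sinhInvSq (lam * (x - y))
      * (C₀ * exp (-2 * lam * (x + y)) + C₁ * exp (2 * lam * (x + y)))

/-- (Ratᵈ-D₂-S-bry) -/
def ratDualD2SBry (A₀ A₁ C₀ C₁ : ℂ) : System where
  Ω := {p | p.1 ≠ 0 ∧ p.2 ≠ 0}
  uM t := A₀ * t ^ 2 + A₁ * t ^ 4
  uP t := A₀ * t ^ 2 + A₁ * t ^ 4
  v t := C₀ / t ^ 2
  w t := C₁ / t ^ 2
  R x y := 2 * A₀ * (x ^ 2 + y ^ 2) + 2 * A₁ * (x ^ 4 + 6 * x ^ 2 * y ^ 2 + y ^ 4)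
    + C₀ / x ^ 2 + C₁ / y ^ 2
  T x y := 32 * A₁ * (C₀ * y ^ 2 + C₁ * x ^ 2)

end TypeB2

end

noncomputable section

/-! ### The commutator identity in a commutative ring with two derivations. -/

namespace TypeB2

/-! Put `h = u⁻(x-y) - u⁺(x+y)` and `q = u⁺(x+y) + u⁻(x-y)`. The chain rule gives `q_x = -h_y` and
`q_y = -h_x`, and `v_y = w_x = 0`. Under these relations the commutator `[P, P₂]` vanishes as soon
as `T_x = 4 w q_x - 2 w' h` and `T_y = 4 v q_y - 2 v' h`. This is a purely algebraic fact about two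
commuting derivations (`derivation_commute`). It applies to functions through the algebra `holo U`
of holomorphic functions on an open set, and so everything reduces to exhibiting a solution `T` of
that first order system (`Compatible`, `System.isCommuting_of_compatible`).

The system is linear in `(u⁻, u⁺)` and linear in `(v, w)`. Hence the elliptic and the hyperbolic
`B₂` families split into basic pairs, which `Compatible.linear_u` and `Compatible.linear_v`
recombine.

The basic elliptic pair is `u = ℘`, `v = w = ℘(· + ω)` with `2ω` a period. Here `T = 2 (u(x-y) +
u(x+y)) (v(x) + v(y)) - 4 v(x) v(y)`, and the system follows from two instances of the addition
theorem for `℘`, at the points `x + ω` and `±(y + ω)` (`Compatible.of_addition`). The addition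
theorem itself (`PeriodPair.addDet_eq_zero`) comes from Liouville's theorem: the determinant has
only removable singularities, so it is constant, and it changes sign under a symmetry. The `℘`
function of a lattice containing the given one with index two is a sum of two translates plus a
constant (`PeriodPair.weierstrassP_of_index_two`). The constant is absorbed by the solution for
constant `v = w`, and this yields all four elliptic combinations.

The hyperbolic family uses the same mechanism with `sinh⁻²` in place of `℘` and the half period
`πi/(2λ)`, supplemented by the entire potential `sinh² 2λt`. In the remaining families `T` is
explicit, and the system becomes an identity of rational functions in the variables or in
exponentials. -/

/-- Two commuting derivations: the operator identity behind `[P, P₂] = 0`. -/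
theorem derivation_commute {A : Type*} [CommRing A] [Algebra ℂ A] (dx dy : Derivation ℂ A A)
    (hc : ∀ a, dy (dx a) = dx (dy a)) (f h q v w T : A)
    (hv : dy v = 0) (hw : dx w = 0) (hqx : dx q = - dy h) (hqy : dy q = - dx h)
    (hTx : dx T = 4 * w * dx q - 2 * dy w * h) (hTy : dy T = 4 * v * dy q - 2 * dx v * h)
    (P P₂ : A → A) (hP : ∀ a, P a = -(1 / 2 : ℂ) • (dx (dx a) + dy (dy a)) + (q + v + w) * a)
    (hP₂ : ∀ a, P₂ a = dx (dy (dx (dy a) + h * a)) + h * (dx (dy a) + h * a)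
      - 2 * w * dx (dx a) - 2 * v * dy (dy a) + (4 * v * w + T) * a) :
    P (P₂ f) = P₂ (P f) := by
  have two : ∀ d : Derivation ℂ A A, d 2 = 0 := fun d => by simpa using d.map_natCast 2
  have four : ∀ d : Derivation ℂ A A, d 4 = 0 := fun d => by simpa using d.map_natCast 4
  -- Equality of the mixed derivatives of `q` forces the wave equation on `h`. Together with the
  -- hypotheses it makes the Leibniz expansion of both sides reducible to a common normal form.
  have hh : dy (dy h) = dx (dx h) := by
    have h1 := hc q
    rw [hqx, hqy] at h1
    simpa using h1
  have hw1 : dx (dy w) = 0 := by rw [← hc, hw, map_zero]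
  have hw2 : dx (dy (dy w)) = 0 := by rw [← hc, hw1, map_zero]
  -- `P' = -2P` carries no complex scalar, so `ring` can compare the two expansions; the factor
  -- `-1/2` returns through the `ℂ`-linearity of `P₂`.
  set P' : A → A := fun a => dx (dx a) + dy (dy a) - 2 * (q + v + w) * a with hP'
  have hPP : ∀ a, P a = -(1 / 2 : ℂ) • P' a := by
    intro a
    have : (2 * (q + v + w)) * a = (2 : ℂ) • ((q + v + w) * a) := by
      rw [Algebra.smul_def, map_ofNat]; ring
    simp only [hP, hP', this]
    module
  have hlin : ∀ (c : ℂ) a, P₂ (c • a) = c • P₂ a := by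
    intro c a
    simp only [hP₂, Derivation.map_smul, mul_smul_comm, ← smul_add, ← smul_sub]
  have key : P' (P₂ f) = P₂ (P' f) := by
    simp only [hP', hP₂, map_add, map_sub, map_neg, map_zero, Derivation.leibniz, smul_eq_mul, two,
      four, hc, hv, hw, hTx, hTy, hqx, hqy, hh, hw1, hw2]
    ring
  rw [hPP, hPP, hlin, key]

end TypeB2

/-! ### Partial derivatives of holomorphic functions on `ℂ²`. -/

namespace TypeB2
open Set Filter Topology

theorem dX_congr {U : Set (ℂ × ℂ)} (hU : IsOpen U) {f g : ℂ × ℂ → ℂ} (h : EqOn f g U) :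
    EqOn (dX f) (dX g) U := by
  intro p hp
  refine Filter.EventuallyEq.deriv_eq ?_
  have hc : ContinuousAt (fun s : ℂ => (s, p.2)) p.1 := by fun_prop
  filter_upwards [hc.preimage_mem_nhds (hU.mem_nhds hp)] with s hs using h hs

theorem dY_congr {U : Set (ℂ × ℂ)} (hU : IsOpen U) {f g : ℂ × ℂ → ℂ} (h : EqOn f g U) :
    EqOn (dY f) (dY g) U := by
  intro p hp
  refine Filter.EventuallyEq.deriv_eq ?_
  have hc : ContinuousAt (fun s : ℂ => (p.1, s)) p.2 := by fun_prop
  filter_upwards [hc.preimage_mem_nhds (hU.mem_nhds hp)] with s hs using h hs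

theorem hasDerivAt_slice_fst {f : ℂ × ℂ → ℂ} {p : ℂ × ℂ} (hf : DifferentiableAt ℂ f p) :
    HasDerivAt (fun s => f (s, p.2)) (fderiv ℂ f p (1, 0)) p.1 :=
  HasFDerivAt.comp_hasDerivAt (f := fun s : ℂ => (s, p.2)) p.1 hf.hasFDerivAt
    ((hasDerivAt_id p.1).prodMk (hasDerivAt_const p.1 p.2))

theorem hasDerivAt_slice_snd {f : ℂ × ℂ → ℂ} {p : ℂ × ℂ} (hf : DifferentiableAt ℂ f p) :
    HasDerivAt (fun s => f (p.1, s)) (fderiv ℂ f p (0, 1)) p.2 :=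
  HasFDerivAt.comp_hasDerivAt (f := fun s : ℂ => (p.1, s)) p.2 hf.hasFDerivAt
    ((hasDerivAt_const p.2 p.1).prodMk (hasDerivAt_id p.2))

theorem dX_eq_fderiv {f : ℂ × ℂ → ℂ} {p : ℂ × ℂ} (hf : DifferentiableAt ℂ f p) :
    dX f p = fderiv ℂ f p (1, 0) := (hasDerivAt_slice_fst hf).deriv

theorem dY_eq_fderiv {f : ℂ × ℂ → ℂ} {p : ℂ × ℂ} (hf : DifferentiableAt ℂ f p) :
    dY f p = fderiv ℂ f p (0, 1) := (hasDerivAt_slice_snd hf).deriv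

section
variable {U : Set (ℂ × ℂ)} {f g : ℂ × ℂ → ℂ}

theorem analyticOnNhd_dX (hf : AnalyticOnNhd ℂ f U) : AnalyticOnNhd ℂ (dX f) U := by
  intro p hp
  let E : ((ℂ × ℂ) →L[ℂ] ℂ) →L[ℂ] ℂ := ContinuousLinearMap.apply ℂ ℂ (1, 0)
  have h : AnalyticAt ℂ (fun p => E (fderiv ℂ f p)) p :=
    (E.analyticAt _).comp (hf p hp).fderiv
  refine h.congr ?_
  filter_upwards [(hf p hp).eventually_analyticAt] with z hz
  exact (dX_eq_fderiv hz.differentiableAt).symm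

theorem analyticOnNhd_dY (hf : AnalyticOnNhd ℂ f U) : AnalyticOnNhd ℂ (dY f) U := by
  intro p hp
  let E : ((ℂ × ℂ) →L[ℂ] ℂ) →L[ℂ] ℂ := ContinuousLinearMap.apply ℂ ℂ (0, 1)
  have h : AnalyticAt ℂ (fun p => E (fderiv ℂ f p)) p :=
    (E.analyticAt _).comp (hf p hp).fderiv
  refine h.congr ?_
  filter_upwards [(hf p hp).eventually_analyticAt] with z hz
  exact (dY_eq_fderiv hz.differentiableAt).symm

theorem dX_add {p : ℂ × ℂ} (hf : AnalyticAt ℂ f p) (hg : AnalyticAt ℂ g p) :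
    dX (f + g) p = dX f p + dX g p := by
  rw [dX_eq_fderiv (hf.add hg).differentiableAt, dX_eq_fderiv hf.differentiableAt,
    dX_eq_fderiv hg.differentiableAt, fderiv_add hf.differentiableAt hg.differentiableAt]
  rfl

theorem dY_add {p : ℂ × ℂ} (hf : AnalyticAt ℂ f p) (hg : AnalyticAt ℂ g p) :
    dY (f + g) p = dY f p + dY g p := by
  rw [dY_eq_fderiv (hf.add hg).differentiableAt, dY_eq_fderiv hf.differentiableAt,
    dY_eq_fderiv hg.differentiableAt, fderiv_add hf.differentiableAt hg.differentiableAt]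
  rfl

theorem dX_mul {p : ℂ × ℂ} (hf : AnalyticAt ℂ f p) (hg : AnalyticAt ℂ g p) :
    dX (f * g) p = f p * dX g p + g p * dX f p := by
  rw [dX_eq_fderiv (hf.mul hg).differentiableAt, dX_eq_fderiv hf.differentiableAt,
    dX_eq_fderiv hg.differentiableAt, fderiv_mul hf.differentiableAt hg.differentiableAt]
  simp

theorem dY_mul {p : ℂ × ℂ} (hf : AnalyticAt ℂ f p) (hg : AnalyticAt ℂ g p) :
    dY (f * g) p = f p * dY g p + g p * dY f p := by
  rw [dY_eq_fderiv (hf.mul hg).differentiableAt, dY_eq_fderiv hf.differentiableAt,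
    dY_eq_fderiv hg.differentiableAt, fderiv_mul hf.differentiableAt hg.differentiableAt]
  simp

theorem dX_smul (c : ℂ) (f : ℂ × ℂ → ℂ) (p : ℂ × ℂ) : dX (c • f) p = c * dX f p := by
  simp [dX, deriv_const_mul_field]

theorem dY_smul (c : ℂ) (f : ℂ × ℂ → ℂ) (p : ℂ × ℂ) : dY (c • f) p = c * dY f p := by
  simp [dY, deriv_const_mul_field]

theorem dY_dX {p : ℂ × ℂ} (hf : AnalyticAt ℂ f p) : dY (dX f) p = dX (dY f) p := by
  have hx : dX f =ᶠ[𝓝 p] fun z => fderiv ℂ f z (1, 0) := by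
    filter_upwards [hf.eventually_analyticAt] with z hz using dX_eq_fderiv hz.differentiableAt
  have hy : dY f =ᶠ[𝓝 p] fun z => fderiv ℂ f z (0, 1) := by
    filter_upwards [hf.eventually_analyticAt] with z hz using dY_eq_fderiv hz.differentiableAt
  have h2 := hf.fderiv.differentiableAt
  have e1 : ∀ v : ℂ × ℂ, fderiv ℂ (fun z => fderiv ℂ f z v) p
      = (fderiv ℂ (fderiv ℂ f) p).flip v := by
    intro v
    ext <;> simp [fderiv_clm_apply h2 (differentiableAt_const v)]
  have hd : ∀ v : ℂ × ℂ, DifferentiableAt ℂ (fun z => fderiv ℂ f z v) p := fun v =>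
    h2.clm_apply (differentiableAt_const v)
  rw [dY_eq_fderiv (hx.differentiableAt_iff.2 (hd _)), hx.fderiv_eq,
    dX_eq_fderiv (hy.differentiableAt_iff.2 (hd _)), hy.fderiv_eq, e1, e1]
  exact (hf.contDiffAt (n := 2)).isSymmSndFDerivAt (by simp) _ _

end

/-! ### The algebra of holomorphic functions on an open set, with its two derivations. -/

section Ring
variable (U : Set (ℂ × ℂ))

/-- Extension by zero of a function on `U`. -/
def ext0 (g : U → ℂ) : ℂ × ℂ → ℂ := Function.extend Subtype.val g 0

@[simp] theorem ext0_apply (g : U → ℂ) (p : U) : ext0 U g p = g p :=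
  Subtype.val_injective.extend_apply _ _ _

theorem ext0_restrict (f : ℂ × ℂ → ℂ) : EqOn (ext0 U (U.domRestrict f)) f U :=
  fun p hp => ext0_apply U (U.domRestrict f) ⟨p, hp⟩

variable {U}

theorem analyticOnNhd_congr (hU : IsOpen U) {f g : ℂ × ℂ → ℂ} (hf : AnalyticOnNhd ℂ f U)
    (h : EqOn f g U) : AnalyticOnNhd ℂ g U := fun p hp =>
  (hf p hp).congr (by filter_upwards [hU.mem_nhds hp] with z hz using h hz)

theorem ext0_mul (f g : U → ℂ) : EqOn (ext0 U f * ext0 U g) (ext0 U (f * g)) U :=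
  fun p hp => by lift p to U using hp; simp

theorem ext0_add (f g : U → ℂ) : EqOn (ext0 U f + ext0 U g) (ext0 U (f + g)) U :=
  fun p hp => by lift p to U using hp; simp

theorem ext0_smul (c : ℂ) (f : U → ℂ) : EqOn (c • ext0 U f) (ext0 U (c • f)) U :=
  fun p hp => by lift p to U using hp; simp

/-- The algebra of holomorphic functions on an open set `U ⊆ ℂ²`. -/
def holo (U : TopologicalSpace.Opens (ℂ × ℂ)) : Subalgebra ℂ (↥(U : Set (ℂ × ℂ)) → ℂ) where
  carrier := {g | AnalyticOnNhd ℂ (ext0 U g) U}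
  mul_mem' {f g} hf hg := analyticOnNhd_congr U.2 (hf.mul hg) (ext0_mul f g)
  add_mem' {f g} hf hg := analyticOnNhd_congr U.2 (hf.add hg) (ext0_add f g)
  algebraMap_mem' c := analyticOnNhd_congr U.2 (analyticOnNhd_const (v := c))
    fun _ hp => (ext0_restrict U (fun _ => c) hp).symm

variable {V : TopologicalSpace.Opens (ℂ × ℂ)}

/-- The restriction to `V` of a function that is holomorphic on `V`. -/
def toHolo (f : ℂ × ℂ → ℂ) (hf : AnalyticOnNhd ℂ f V) : holo V :=
  ⟨(V : Set (ℂ × ℂ)).domRestrict f, analyticOnNhd_congr V.2 hf (ext0_restrict _ f).symm⟩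

theorem toHolo_apply (f : ℂ × ℂ → ℂ) (hf : AnalyticOnNhd ℂ f V) (p : (V : Set (ℂ × ℂ))) :
    (toHolo f hf).1 p = f p := rfl

/-- `∂/∂x` as a derivation of the algebra of holomorphic functions. -/
def derX (V : TopologicalSpace.Opens (ℂ × ℂ)) : Derivation ℂ (holo V) (holo V) :=
  Derivation.mk'
    { toFun := fun g => toHolo (dX (ext0 V g.1)) (analyticOnNhd_dX g.2)
      map_add' := fun f g => by
        ext p
        exact (dX_congr V.2 (ext0_add f.1 g.1) p.2).symm.trans (dX_add (f.2 p p.2) (g.2 p p.2))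
      map_smul' := fun c g => by
        ext p
        exact (dX_congr V.2 (ext0_smul c g.1) p.2).symm.trans (dX_smul c _ _) }
    fun f g => by
      ext p
      refine (dX_congr V.2 (ext0_mul f.1 g.1) p.2).symm.trans
        ((dX_mul (f.2 p p.2) (g.2 p p.2)).trans ?_)
      rw [ext0_apply, ext0_apply]; rfl

/-- `∂/∂y` as a derivation of the algebra of holomorphic functions. -/
def derY (V : TopologicalSpace.Opens (ℂ × ℂ)) : Derivation ℂ (holo V) (holo V) :=
  Derivation.mk'
    { toFun := fun g => toHolo (dY (ext0 V g.1)) (analyticOnNhd_dY g.2)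
      map_add' := fun f g => by
        ext p
        exact (dY_congr V.2 (ext0_add f.1 g.1) p.2).symm.trans (dY_add (f.2 p p.2) (g.2 p p.2))
      map_smul' := fun c g => by
        ext p
        exact (dY_congr V.2 (ext0_smul c g.1) p.2).symm.trans (dY_smul c _ _) }
    fun f g => by
      ext p
      refine (dY_congr V.2 (ext0_mul f.1 g.1) p.2).symm.trans
        ((dY_mul (f.2 p p.2) (g.2 p p.2)).trans ?_)
      rw [ext0_apply, ext0_apply]; rfl

theorem derX_toHolo (f : ℂ × ℂ → ℂ) (hf : AnalyticOnNhd ℂ f V) :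
    derX V (toHolo f hf) = toHolo (dX f) (analyticOnNhd_dX hf) := by
  ext p
  exact dX_congr V.2 (ext0_restrict _ f) p.2

theorem derY_toHolo (f : ℂ × ℂ → ℂ) (hf : AnalyticOnNhd ℂ f V) :
    derY V (toHolo f hf) = toHolo (dY f) (analyticOnNhd_dY hf) := by
  ext p
  exact dY_congr V.2 (ext0_restrict _ f) p.2

theorem derY_derX (a : holo V) : derY V (derX V a) = derX V (derY V a) := by
  obtain ⟨f, hf, rfl⟩ : ∃ f, ∃ hf : AnalyticOnNhd ℂ f (V : Set (ℂ × ℂ)), a = toHolo f hf :=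
    ⟨ext0 V a.1, a.2, by ext p; exact (ext0_apply (V : Set (ℂ × ℂ)) a.1 p).symm⟩
  rw [derX_toHolo, derY_toHolo, derY_toHolo, derX_toHolo]
  ext p
  exact dY_dX (hf p p.2)

end Ring
end TypeB2

/-! ### From the first order system for `T` to the commutation of `P` and `P₂`. -/

namespace TypeB2
open Set Filter Topology

/-- The first order system for `T` that is equivalent to `[P, P₂] = 0`. -/
structure Compatible (Ω : Set (ℂ × ℂ)) (uM uP v w : ℂ → ℂ) (T : ℂ → ℂ → ℂ) : Prop where
  uM_an : ∀ p ∈ Ω, AnalyticAt ℂ uM (p.1 - p.2)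
  uP_an : ∀ p ∈ Ω, AnalyticAt ℂ uP (p.1 + p.2)
  v_an : ∀ p ∈ Ω, AnalyticAt ℂ v p.1
  w_an : ∀ p ∈ Ω, AnalyticAt ℂ w p.2
  T_an : AnalyticOnNhd ℂ (fun p => T p.1 p.2) Ω
  T_x : ∀ p ∈ Ω, deriv (fun s => T s p.2) p.1 =
    4 * w p.2 * (deriv uP (p.1 + p.2) + deriv uM (p.1 - p.2))
      - 2 * deriv w p.2 * (uM (p.1 - p.2) - uP (p.1 + p.2))
  T_y : ∀ p ∈ Ω, deriv (fun s => T p.1 s) p.2 =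
    4 * v p.1 * (deriv uP (p.1 + p.2) - deriv uM (p.1 - p.2))
      - 2 * deriv v p.1 * (uM (p.1 - p.2) - uP (p.1 + p.2))

namespace Compatible

variable {Ω U : Set (ℂ × ℂ)} {uM uP v w : ℂ → ℂ} {T : ℂ → ℂ → ℂ}

theorem mono (h : Compatible Ω uM uP v w T) (hU : U ⊆ Ω) : Compatible U uM uP v w T where
  uM_an p hp := h.uM_an p (hU hp)
  uP_an p hp := h.uP_an p (hU hp)
  v_an p hp := h.v_an p (hU hp)
  w_an p hp := h.w_an p (hU hp)
  T_an p hp := h.T_an p (hU hp)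
  T_x p hp := h.T_x p (hU hp)
  T_y p hp := h.T_y p (hU hp)

theorem analytic_uM (h : Compatible Ω uM uP v w T) :
    AnalyticOnNhd ℂ (fun p => uM (p.1 - p.2)) Ω := fun p hp =>
  (h.uM_an p hp).fun_comp (f := fun p : ℂ × ℂ => p.1 - p.2) (analyticAt_fst.sub analyticAt_snd)

theorem analytic_uP (h : Compatible Ω uM uP v w T) :
    AnalyticOnNhd ℂ (fun p => uP (p.1 + p.2)) Ω := fun p hp =>
  (h.uP_an p hp).fun_comp (f := fun p : ℂ × ℂ => p.1 + p.2) (analyticAt_fst.add analyticAt_snd)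

theorem analytic_v (h : Compatible Ω uM uP v w T) :
    AnalyticOnNhd ℂ (fun p => v p.1) Ω := fun p hp =>
  (h.v_an p hp).fun_comp (f := fun p : ℂ × ℂ => p.1) analyticAt_fst

theorem analytic_w (h : Compatible Ω uM uP v w T) :
    AnalyticOnNhd ℂ (fun p => w p.2) Ω := fun p hp =>
  (h.w_an p hp).fun_comp (f := fun p : ℂ × ℂ => p.2) analyticAt_snd

theorem analytic_h (h : Compatible Ω uM uP v w T) :
    AnalyticOnNhd ℂ (fun p => uM (p.1 - p.2) - uP (p.1 + p.2)) Ω :=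
  h.analytic_uM.sub h.analytic_uP

theorem analytic_q (h : Compatible Ω uM uP v w T) :
    AnalyticOnNhd ℂ (fun p => uP (p.1 + p.2) + uM (p.1 - p.2)) Ω :=
  h.analytic_uP.add h.analytic_uM

end Compatible

theorem dX_comp_sub (u : ℂ → ℂ) (p : ℂ × ℂ) :
    dX (fun p => u (p.1 - p.2)) p = deriv u (p.1 - p.2) := by
  simp [dX, deriv_comp_sub_const]

theorem dY_comp_sub (u : ℂ → ℂ) (p : ℂ × ℂ) :
    dY (fun p => u (p.1 - p.2)) p = -deriv u (p.1 - p.2) := by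
  simp [dY, deriv_comp_const_sub]

theorem dX_comp_add (u : ℂ → ℂ) (p : ℂ × ℂ) :
    dX (fun p => u (p.1 + p.2)) p = deriv u (p.1 + p.2) := by
  simp [dX, deriv_comp_add_const]

theorem dY_comp_add (u : ℂ → ℂ) (p : ℂ × ℂ) :
    dY (fun p => u (p.1 + p.2)) p = deriv u (p.1 + p.2) := by
  simp [dY, deriv_comp_const_add]

namespace System
variable {s : System} {V : TopologicalSpace.Opens (ℂ × ℂ)}

theorem analytic_R (hR : ∀ p : ℂ × ℂ, p ∈ V →
      s.R p.1 p.2 = s.uP (p.1 + p.2) + s.uM (p.1 - p.2) + s.v p.1 + s.w p.2)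
    (h : Compatible V s.uM s.uP s.v s.w s.T) : AnalyticOnNhd ℂ (fun p : ℂ × ℂ => s.R p.1 p.2) V :=
  analyticOnNhd_congr V.2 ((h.analytic_q.add h.analytic_v).add h.analytic_w)
    fun p hp => (hR p hp).symm

theorem analytic_P (hR : AnalyticOnNhd ℂ (fun p : ℂ × ℂ => s.R p.1 p.2) V) {f : ℂ × ℂ → ℂ}
    (hf : AnalyticOnNhd ℂ f V) : AnalyticOnNhd ℂ (s.P f) V :=
  (analyticOnNhd_const.mul ((analyticOnNhd_dX (analyticOnNhd_dX hf)).add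
    (analyticOnNhd_dY (analyticOnNhd_dY hf)))).add (hR.mul hf)

theorem analytic_D (h : Compatible V s.uM s.uP s.v s.w s.T) {f : ℂ × ℂ → ℂ}
    (hf : AnalyticOnNhd ℂ f V) : AnalyticOnNhd ℂ (s.D f) V :=
  (analyticOnNhd_dX (analyticOnNhd_dY hf)).add (h.analytic_h.mul hf)

theorem analytic_P₂ (h : Compatible V s.uM s.uP s.v s.w s.T) {f : ℂ × ℂ → ℂ}
    (hf : AnalyticOnNhd ℂ f V) : AnalyticOnNhd ℂ (s.P₂ f) V :=
  (((analytic_D h (analytic_D h hf)).sub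
    ((analyticOnNhd_const.mul h.analytic_w).mul (analyticOnNhd_dX (analyticOnNhd_dX hf)))).sub
    ((analyticOnNhd_const.mul h.analytic_v).mul (analyticOnNhd_dY (analyticOnNhd_dY hf)))).add
    ((((analyticOnNhd_const.mul h.analytic_v).mul h.analytic_w).add h.T_an).mul hf)

theorem toHolo_P (hR : ∀ p : ℂ × ℂ, p ∈ V →
      s.R p.1 p.2 = s.uP (p.1 + p.2) + s.uM (p.1 - p.2) + s.v p.1 + s.w p.2)
    (h : Compatible V s.uM s.uP s.v s.w s.T) {f : ℂ × ℂ → ℂ} (hf : AnalyticOnNhd ℂ f V) :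
    toHolo (s.P f) (analytic_P (analytic_R hR h) hf) =
      -(1 / 2 : ℂ) • (derX V (derX V (toHolo f hf)) + derY V (derY V (toHolo f hf)))
        + (toHolo _ h.analytic_q + toHolo _ h.analytic_v + toHolo _ h.analytic_w)
          * toHolo f hf := by
  simp only [derX_toHolo, derY_toHolo]
  ext p
  exact congrArg (fun z => -(1 / 2) * (dX (dX f) p + dY (dY f) p) + z * f p) (hR p p.2)

theorem toHolo_D (h : Compatible V s.uM s.uP s.v s.w s.T) {f : ℂ × ℂ → ℂ}
    (hf : AnalyticOnNhd ℂ f V) :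
    toHolo (s.D f) (analytic_D h hf) =
      derX V (derY V (toHolo f hf)) + toHolo _ h.analytic_h * toHolo f hf := by
  simp only [derX_toHolo, derY_toHolo]
  rfl

theorem toHolo_P₂ (h : Compatible V s.uM s.uP s.v s.w s.T) {f : ℂ × ℂ → ℂ}
    (hf : AnalyticOnNhd ℂ f V) :
    toHolo (s.P₂ f) (analytic_P₂ h hf) =
      derX V (derY V (derX V (derY V (toHolo f hf)) + toHolo _ h.analytic_h * toHolo f hf))
        + toHolo _ h.analytic_h
          * (derX V (derY V (toHolo f hf)) + toHolo _ h.analytic_h * toHolo f hf)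
        - 2 * toHolo _ h.analytic_w * derX V (derX V (toHolo f hf))
        - 2 * toHolo _ h.analytic_v * derY V (derY V (toHolo f hf))
        + (4 * toHolo _ h.analytic_v * toHolo _ h.analytic_w + toHolo _ h.T_an)
          * toHolo f hf := by
  rw [← toHolo_D h hf]
  simp only [derX_toHolo, derY_toHolo]
  rfl

theorem dX_q (h : Compatible V s.uM s.uP s.v s.w s.T) {p : ℂ × ℂ} (hp : p ∈ V) :
    dX (fun p => s.uP (p.1 + p.2) + s.uM (p.1 - p.2)) p
      = deriv s.uP (p.1 + p.2) + deriv s.uM (p.1 - p.2) :=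
  (dX_add (h.analytic_uP p hp) (h.analytic_uM p hp)).trans (by rw [dX_comp_add, dX_comp_sub])

theorem dY_q (h : Compatible V s.uM s.uP s.v s.w s.T) {p : ℂ × ℂ} (hp : p ∈ V) :
    dY (fun p => s.uP (p.1 + p.2) + s.uM (p.1 - p.2)) p
      = deriv s.uP (p.1 + p.2) - deriv s.uM (p.1 - p.2) :=
  (dY_add (h.analytic_uP p hp) (h.analytic_uM p hp)).trans
    (by rw [dY_comp_add, dY_comp_sub, ← sub_eq_add_neg])

theorem dX_h (h : Compatible V s.uM s.uP s.v s.w s.T) {p : ℂ × ℂ} (hp : p ∈ V) :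
    dX (fun p => s.uM (p.1 - p.2) - s.uP (p.1 + p.2)) p
      = deriv s.uM (p.1 - p.2) - deriv s.uP (p.1 + p.2) := by
  have h1 := dX_add (h.analytic_uM p hp) (h.analytic_uP p hp).neg
  have h2 := dX_smul (-1) (fun p => s.uP (p.1 + p.2)) p
  rw [neg_one_smul] at h2
  rw [h2, dX_comp_add, dX_comp_sub] at h1
  simp only [sub_eq_add_neg, ← neg_one_mul (deriv s.uP _)]
  exact h1

theorem dY_h (h : Compatible V s.uM s.uP s.v s.w s.T) {p : ℂ × ℂ} (hp : p ∈ V) :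
    dY (fun p => s.uM (p.1 - p.2) - s.uP (p.1 + p.2)) p
      = -deriv s.uM (p.1 - p.2) - deriv s.uP (p.1 + p.2) := by
  have h1 := dY_add (h.analytic_uM p hp) (h.analytic_uP p hp).neg
  have h2 := dY_smul (-1) (fun p => s.uP (p.1 + p.2)) p
  rw [neg_one_smul] at h2
  rw [h2, dY_comp_add, dY_comp_sub] at h1
  simp only [sub_eq_add_neg, ← neg_one_mul (deriv s.uP _)]
  exact h1

/-- Restriction to `V` carries `P` and `P₂` to operators built from `derX V` and `derY V`, so the
ring identity can be applied there and then evaluated at a point. -/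
theorem commute_of_compatible
    (hR : ∀ p : ℂ × ℂ, p ∈ V →
      s.R p.1 p.2 = s.uP (p.1 + p.2) + s.uM (p.1 - p.2) + s.v p.1 + s.w p.2)
    (h : Compatible V s.uM s.uP s.v s.w s.T) {f : ℂ × ℂ → ℂ} (hf : AnalyticOnNhd ℂ f V)
    (p : ℂ × ℂ) (hp : p ∈ V) : s.P (s.P₂ f) p = s.P₂ (s.P f) p := by
  have key := derivation_commute (derX V) (derY V) derY_derX (toHolo f hf)
    (toHolo _ h.analytic_h) (toHolo _ h.analytic_q) (toHolo _ h.analytic_v)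
    (toHolo _ h.analytic_w) (toHolo _ h.T_an)
    (by rw [derY_toHolo]; ext p; simp [toHolo_apply, dY])
    (by rw [derX_toHolo]; ext p; simp [toHolo_apply, dX])
    (by
      rw [derX_toHolo, derY_toHolo]
      ext p
      refine (dX_q h p.2).trans (Eq.trans ?_ (congrArg Neg.neg (dY_h h p.2)).symm)
      ring)
    (by
      rw [derX_toHolo, derY_toHolo]
      ext p
      refine (dY_q h p.2).trans (Eq.trans ?_ (congrArg Neg.neg (dX_h h p.2)).symm)
      ring)
    (by
      rw [derX_toHolo, derX_toHolo, derY_toHolo]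
      ext p
      refine (h.T_x p p.2).trans ?_
      rw [← dX_q h p.2]
      rfl)
    (by
      rw [derY_toHolo, derY_toHolo, derX_toHolo]
      ext p
      refine (h.T_y p p.2).trans ?_
      rw [← dY_q h p.2]
      rfl) _ _ (fun _ => rfl) (fun _ => rfl)
  rw [← toHolo_P₂ h hf, ← toHolo_P hR h (analytic_P₂ h hf), ← toHolo_P hR h hf,
    ← toHolo_P₂ h (analytic_P (analytic_R hR h) hf)] at key
  exact congrFun (congrArg Subtype.val key) ⟨p, hp⟩

/-- Leibniz expansion of the square `(∂ₓ∂ᵧ + H)²`. It displays the leading term `∂ₓ²∂ᵧ²` and shows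
that everything else has order at most two. -/
theorem P₂_eq (h : Compatible V s.uM s.uP s.v s.w s.T) {f : ℂ × ℂ → ℂ}
    (hf : AnalyticOnNhd ℂ f V) {p : ℂ × ℂ} (hp : p ∈ V) {H : ℂ × ℂ → ℂ}
    (hH : H = fun p => s.uM (p.1 - p.2) - s.uP (p.1 + p.2)) :
    s.P₂ f p = dX (dX (dY (dY f))) p + (dX (dY H) p + H p ^ 2 + 4 * s.v p.1 * s.w p.2
      + s.T p.1 p.2) * f p + dX H p * dY f p + dY H p * dX f p + 2 * H p * dX (dY f) p
      - 2 * s.w p.2 * dX (dX f) p - 2 * s.v p.1 * dY (dY f) p := by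
  subst hH
  have key := toHolo_P₂ h hf
  simp only [map_add, Derivation.leibniz, smul_eq_mul, derX_toHolo, derY_toHolo] at key
  refine (congrFun (congrArg Subtype.val key) ⟨p, hp⟩).trans ?_
  simp only [Subalgebra.coe_add, Subalgebra.coe_sub, Subalgebra.coe_mul, Pi.add_apply, Pi.sub_apply,
    Pi.mul_apply, toHolo_apply]
  change _ - 2 * _ * _ - 2 * _ * _ + (4 * _ * _ + _) * _ = _
  -- The square produces `∂ₓ∂ᵧ∂ₓ∂ᵧ f`; the inner pair is interchanged to reach `∂ₓ²∂ᵧ² f`.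
  rw [dX_congr V.2 (fun z hz => dY_dX (analyticOnNhd_dY hf z hz)) hp]
  ring

/-- The coefficients of the lower order part of `P₂`. -/
def coeff (s : System) (H : ℂ × ℂ → ℂ) : ℕ → ℕ → ℂ × ℂ → ℂ
  | 0, 0 => fun p => dX (dY H) p + H p ^ 2 + 4 * s.v p.1 * s.w p.2 + s.T p.1 p.2
  | 0, 1 => dX H
  | 1, 0 => dY H
  | 1, 1 => fun p => 2 * H p
  | 2, 0 => fun p => -2 * s.w p.2
  | 0, 2 => fun p => -2 * s.v p.1
  | _, _ => 0

theorem isCommuting_of_compatible (s : System) (hΩ : IsOpen s.Ω)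
    (hR : ∀ x y, (x, y) ∈ s.Ω → s.R x y = s.uP (x + y) + s.uM (x - y) + s.v x + s.w y)
    (h : Compatible s.Ω s.uM s.uP s.v s.w s.T) : s.IsCommuting where
  isOpen := hΩ
  potential := hR
  analytic := analytic_R (V := ⟨s.Ω, hΩ⟩) (fun p hp => hR p.1 p.2 hp) h
  order := by
    refine ⟨coeff s fun p => s.uM (p.1 - p.2) - s.uP (p.1 + p.2), fun i j => ?_,
      fun U hU hUΩ f hf p hp => ?_⟩
    · unfold coeff
      split
      · exact (((analyticOnNhd_dX (analyticOnNhd_dY h.analytic_h)).add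
          (h.analytic_h.pow 2)).add ((analyticOnNhd_const.mul h.analytic_v).mul h.analytic_w)).add
          h.T_an
      · exact analyticOnNhd_dX h.analytic_h
      · exact analyticOnNhd_dY h.analytic_h
      · exact analyticOnNhd_const.mul h.analytic_h
      · exact analyticOnNhd_const.mul h.analytic_w
      · exact analyticOnNhd_const.mul h.analytic_v
      · exact analyticOnNhd_const
    · have := P₂_eq (V := ⟨U, hU⟩) (h.mono hUΩ) hf hp rfl
      simp only [this, Finset.sum_range_succ, Finset.sum_range_zero, coeff, Function.iterate_succ,
        Function.iterate_zero, Function.comp_apply, id_eq, Pi.zero_apply, Nat.reduceSub, zero_mul]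
      ring
  commute U hU hUΩ _ hf := commute_of_compatible (V := ⟨U, hU⟩)
    (fun p hp => hR p.1 p.2 (hUΩ hp)) (h.mono hUΩ) hf

end System
end TypeB2

/-! ### The addition theorem for the Weierstrass function. -/

namespace PeriodPair
open Set Filter Topology

variable (L : PeriodPair)

theorem eventually_notMem_lattice {f : ℂ → ℂ} {x : ℂ} (hf : ContinuousAt f x)
    (hx : f x ∉ L.lattice) : ∀ᶠ z in 𝓝 x, f z ∉ L.lattice :=
  hf.preimage_mem_nhds (L.isClosed_lattice.isOpen_compl.mem_nhds hx)

theorem analyticAt_weierstrassP {x : ℂ} (hx : x ∉ L.lattice) : AnalyticAt ℂ L.weierstrassP x :=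
  L.analyticOnNhd_weierstrassP x hx

theorem analyticAt_derivWeierstrassP {x : ℂ} (hx : x ∉ L.lattice) :
    AnalyticAt ℂ L.derivWeierstrassP x :=
  L.analyticOnNhd_derivWeierstrassP x hx

theorem hasDerivAt_weierstrassP {x : ℂ} (hx : x ∉ L.lattice) :
    HasDerivAt L.weierstrassP (L.derivWeierstrassP x) x := by
  rw [← L.deriv_weierstrassP]
  exact (L.analyticAt_weierstrassP hx).differentiableAt.hasDerivAt

/-- A function which has only removable singularities and is periodic with respect to a lattice is
constant, apart from the singularities. -/
theorem eq_of_periodic_of_removable {f : ℂ → ℂ} (hper : ∀ z, ∀ l ∈ L.lattice, f (z + l) = f z)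
    (hf : ∀ z, ∃ g : ℂ → ℂ, AnalyticAt ℂ g z ∧ f =ᶠ[𝓝[≠] z] g) {x y : ℂ}
    (hx : ContinuousAt f x) (hy : ContinuousAt f y) : f x = f y := by
  choose g hg hfg using hf
  -- `F z` is the punctured limit of `f` at `z`, so it depends only on `f` although the germs `g z`
  -- are chosen. Near `z` it agrees with `g z`, hence it is entire and inherits the periods; being
  -- bounded, it is constant.
  let F : ℂ → ℂ := fun z => g z z
  have hlim : ∀ z, Tendsto f (𝓝[≠] z) (𝓝 (F z)) := fun z =>
    ((hg z).continuousAt.tendsto.mono_left nhdsWithin_le_nhds).congr' (hfg z).symm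
  have hloc : ∀ z, F =ᶠ[𝓝 z] g z := by
    intro z
    have h1 : ∀ᶠ w in 𝓝[≠] z, ContinuousAt (g z) w :=
      (hg z).eventually_continuousAt.filter_mono nhdsWithin_le_nhds
    have h2 : ∀ᶠ w in 𝓝[≠] z, F w = g z w := by
      filter_upwards [h1, (eventually_eventually_nhdsWithin.2 (hfg z)), self_mem_nhdsWithin]
        with w hw hw2 hwz
      have h3 : f =ᶠ[𝓝[≠] w] g z := by
        have : ∀ᶠ u in 𝓝 w, f u = g z u := by
          rwa [IsOpen.nhdsWithin_eq isOpen_compl_singleton hwz] at hw2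
        exact this.filter_mono nhdsWithin_le_nhds
      exact tendsto_nhds_unique (hlim w)
        ((hw.tendsto.mono_left nhdsWithin_le_nhds).congr' h3.symm)
    rw [eventually_nhdsWithin_iff] at h2
    filter_upwards [h2] with w hw
    by_cases hwz : w = z
    · rw [hwz]
    · exact hw hwz
  have hF : Differentiable ℂ F := fun z => ((hg z).congr (hloc z).symm).differentiableAt
  have hFper : ∀ z, ∀ l ∈ L.lattice, F (z + l) = F z := by
    intro z l hl
    refine tendsto_nhds_unique (hlim (z + l)) ?_
    have : Tendsto (fun w => w - l) (𝓝[≠] (z + l)) (𝓝[≠] z) := by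
      refine tendsto_nhdsWithin_iff.2 ⟨?_, ?_⟩
      · have : Tendsto (fun w => w - l) (𝓝 (z + l)) (𝓝 (z + l - l)) :=
          (continuous_id.sub continuous_const).tendsto _
        rw [add_sub_cancel_right] at this
        exact this.mono_left nhdsWithin_le_nhds
      · filter_upwards [self_mem_nhdsWithin] with w hw h
        have h : w - l = z := h
        exact hw (by rw [← h]; simp)
    refine ((hlim z).comp this).congr fun w => ?_
    rw [Function.comp_apply, ← hper (w - l) l hl, sub_add_cancel]
  have hFc : F x = F y := hF.apply_eq_apply_of_bounded
    (IsZLattice.isCompact_range_of_periodic L.lattice F hF.continuous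
      fun z w hw => hFper z w hw).isBounded x y
  have hcont : ∀ {z}, ContinuousAt f z → f z = F z := fun {z} hz =>
    tendsto_nhds_unique (hz.tendsto.mono_left nhdsWithin_le_nhds) (hlim z)
  rw [hcont hx, hcont hy, hFc]

/-- The determinant of the rows `(1, ℘, ℘')` at `x`, `y` and `-(x + y)`. -/
def addDet (y x : ℂ) : ℂ :=
  L.derivWeierstrassP (x + y) * (L.weierstrassP x - L.weierstrassP y)
    + L.weierstrassP (x + y) * (L.derivWeierstrassP x - L.derivWeierstrassP y)
    + L.weierstrassP x * L.derivWeierstrassP y - L.derivWeierstrassP x * L.weierstrassP y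

/-- The substitution `x ↦ -(x + y)` exchanges the first and the third row of the determinant, since
the third argument becomes `x`. -/
theorem addDet_neg_add (y x : ℂ) : L.addDet y (-(x + y)) = -L.addDet y x := by
  have h : -(x + y) + y = -x := by ring
  simp only [addDet, h, L.weierstrassP_neg, L.derivWeierstrassP_neg]
  ring

theorem addDet_add_period (y x : ℂ) {l : ℂ} (hl : l ∈ L.lattice) :
    L.addDet y (x + l) = L.addDet y x := by
  lift l to L.lattice using hl
  simp only [addDet, add_right_comm x (l : ℂ) y, L.weierstrassP_add_coe,
    L.derivWeierstrassP_add_coe]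

theorem analyticAt_addDet {y x : ℂ} (hx : x ∉ L.lattice) (hxy : x + y ∉ L.lattice) :
    AnalyticAt ℂ (L.addDet y) x := by
  have h1 := L.analyticAt_weierstrassP hx
  have h2 := L.analyticAt_derivWeierstrassP hx
  have h3 : AnalyticAt ℂ (fun z => L.weierstrassP (z + y)) x :=
    (L.analyticAt_weierstrassP hxy).fun_comp (f := fun z => z + y) (by fun_prop)
  have h4 : AnalyticAt ℂ (fun z => L.derivWeierstrassP (z + y)) x :=
    (L.analyticAt_derivWeierstrassP hxy).fun_comp (f := fun z => z + y) (by fun_prop)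
  unfold addDet
  fun_prop

/-- If `c` is analytic at `0` then `-2 (c(x) - c(0)) + x (c'(x) + c'(0))` is divisible
by `x ^ 3`. -/
theorem exists_analyticAt_cube_mul {c : ℂ → ℂ} (hc : AnalyticAt ℂ c 0) :
    ∃ n : ℂ → ℂ, AnalyticAt ℂ n 0 ∧
      ∀ᶠ x in 𝓝 0, -2 * (c x - c 0) + x * (deriv c x + deriv c 0) = x ^ 3 * n x := by
  have hd : ∀ g : ℂ → ℂ, AnalyticAt ℂ g 0 →
      ∃ g₁ : ℂ → ℂ, AnalyticAt ℂ g₁ 0 ∧ ∀ᶠ x in 𝓝 0, g x = g 0 + x * g₁ x := by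
    intro g hg
    refine ⟨dslope g 0, hg.imp' _ fun p hp => hp.has_fpower_series_dslope_fslope,
      Eventually.of_forall fun x => ?_⟩
    have := sub_smul_dslope g 0 x
    simp only [sub_zero, smul_eq_mul] at this
    rw [this]; ring
  obtain ⟨c₁, hc₁, e₁⟩ := hd c hc
  obtain ⟨c₂, hc₂, e₂⟩ := hd c₁ hc₁
  obtain ⟨c₃, hc₃, e₃⟩ := hd c₂ hc₂
  have hexp : c =ᶠ[𝓝 0] fun x => c 0 + x * (c₁ 0 + x * (c₂ 0 + x * c₃ x)) := by
    filter_upwards [e₁, e₂, e₃] with x h1 h2 h3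
    rw [h1, h2, h3]
  have hder : ∀ᶠ x in 𝓝 0, deriv c x =
      c₁ 0 + 2 * x * c₂ 0 + 3 * x ^ 2 * c₃ x + x ^ 3 * deriv c₃ x := by
    filter_upwards [hexp.eventually_nhds, hc₃.eventually_analyticAt] with x hx hx₃
    rw [EventuallyEq.deriv_eq hx]
    have h3 := hx₃.differentiableAt.hasDerivAt
    have := ((hasDerivAt_id x).mul (((hasDerivAt_id x).mul (((hasDerivAt_id x).mul h3).const_add
      (c₂ 0))).const_add (c₁ 0))).const_add (c 0)
    refine this.deriv.trans ?_
    simp only [id_eq, Pi.mul_apply]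
    ring
  -- With `c = c(0) + αx + βx² + x³c₃`, the terms in `x` and `x²` cancel, and what remains is `x³
  -- (c₃ + x c₃')`.
  refine ⟨fun x => c₃ x + x * deriv c₃ x, by fun_prop, ?_⟩
  have h0 := hder.self_of_nhds
  filter_upwards [hexp, hder] with x h1 h2
  rw [h1, h2, h0]
  ring

/-- Insert `℘(x) = x⁻² + …` and `℘'(x) = -2x⁻³ + …`. With `c(x) = ℘(x + y)`, the polar part of the
determinant is `x⁻³ (-2 (c(x) - c(0)) + x (c'(x) + c'(0)))`, which is holomorphic at `0` by
`exists_analyticAt_cube_mul`. -/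
theorem addDet_removable_zero {y : ℂ} (hy : y ∉ L.lattice) :
    ∃ g : ℂ → ℂ, AnalyticAt ℂ g 0 ∧ L.addDet y =ᶠ[𝓝[≠] 0] g := by
  have hc : AnalyticAt ℂ (fun z => L.weierstrassP (z + y)) 0 :=
    AnalyticAt.fun_comp (f := fun z => z + y) (by simpa using L.analyticAt_weierstrassP hy)
      (by fun_prop)
  have hc' : deriv (fun z => L.weierstrassP (z + y)) = fun z => L.derivWeierstrassP (z + y) := by
    ext z
    rw [deriv_comp_add_const, L.deriv_weierstrassP]
  have hcd : AnalyticAt ℂ (fun z => L.derivWeierstrassP (z + y)) 0 := hc' ▸ hc.deriv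
  obtain ⟨n, hn, hn'⟩ := exists_analyticAt_cube_mul hc
  simp only [hc', zero_add] at hn'
  have hr : AnalyticAt ℂ (L.weierstrassPExcept 0) 0 := L.analyticAt_weierstrassPExcept 0
  have hr' : AnalyticAt ℂ (L.derivWeierstrassPExcept 0) 0 := L.analyticAt_derivWeierstrassPExcept 0
  refine ⟨fun x => n x + L.derivWeierstrassPExcept 0 x * (L.weierstrassP (x + y) - L.weierstrassP y)
    + L.weierstrassPExcept 0 x * (L.derivWeierstrassP (x + y) + L.derivWeierstrassP y)
    - L.derivWeierstrassP (x + y) * L.weierstrassP y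
    - L.weierstrassP (x + y) * L.derivWeierstrassP y, by fun_prop, ?_⟩
  filter_upwards [hn'.filter_mono nhdsWithin_le_nhds, self_mem_nhdsWithin] with x hx hx0
  have hx0 : x ≠ 0 := hx0
  have e1 := L.weierstrassPExcept_add 0 x
  have e2 := L.derivWeierstrassPExcept_sub 0 x
  simp only [ZeroMemClass.coe_zero, sub_zero] at e1 e2
  have hn2 : n x = (-2 * (L.weierstrassP (x + y) - L.weierstrassP y)
      + x * (L.derivWeierstrassP (x + y) + L.derivWeierstrassP y)) / x ^ 3 := by
    rw [hx]; field_simp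
  rw [hn2, addDet, ← e1, ← e2]
  field_simp
  ring

/-- Injectivity keeps `φ` from hitting `φ z` at other points, so punctured neighbourhoods are mapped
into punctured neighbourhoods. It transports removability from `0` to the other possible poles. -/
theorem removable_comp {f φ : ℂ → ℂ} {z : ℂ} (hφ : AnalyticAt ℂ φ z)
    (hinj : Function.Injective φ)
    (h : ∃ g : ℂ → ℂ, AnalyticAt ℂ g (φ z) ∧ f =ᶠ[𝓝[≠] φ z] g) :
    ∃ g : ℂ → ℂ, AnalyticAt ℂ g z ∧ (f ∘ φ) =ᶠ[𝓝[≠] z] g := by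
  obtain ⟨g, hg, e⟩ := h
  refine ⟨g ∘ φ, hg.comp hφ, ?_⟩
  have : Tendsto φ (𝓝[≠] z) (𝓝[≠] φ z) := tendsto_nhdsWithin_iff.2
    ⟨hφ.continuousAt.tendsto.mono_left nhdsWithin_le_nhds, by
      filter_upwards [self_mem_nhdsWithin] with w hw h using hw (hinj h)⟩
  exact this.eventually e

/-- Possible poles in `x` lie where `x` or `x + y` is a period. Translation moves the first kind to
`0`, and the symmetry `x ↦ -(x + y)` moves the second kind to the first. The determinant is
therefore constant, and its values at `x` and `-(x + y)` are opposite. -/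
theorem addDet_eq_zero {x y : ℂ} (hx : x ∉ L.lattice) (hy : y ∉ L.lattice)
    (hxy : x + y ∉ L.lattice) : L.addDet y x = 0 := by
  have hrem : ∀ z, ∃ g : ℂ → ℂ, AnalyticAt ℂ g z ∧ L.addDet y =ᶠ[𝓝[≠] z] g := by
    have shift : ∀ l ∈ L.lattice, ∃ g : ℂ → ℂ, AnalyticAt ℂ g l ∧ L.addDet y =ᶠ[𝓝[≠] l] g := by
      intro l hl
      have h0 := L.addDet_removable_zero hy
      rw [← sub_self l] at h0
      obtain ⟨g, hg, e⟩ := removable_comp (φ := fun z => z - l) (by fun_prop)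
        (sub_left_injective) h0
      refine ⟨g, hg, ?_⟩
      filter_upwards [e] with z hz
      rw [← hz, Function.comp_apply, ← L.addDet_add_period y (z - l) hl, sub_add_cancel]
    intro z
    by_cases hz : z ∈ L.lattice
    · exact shift z hz
    by_cases hzy : z + y ∈ L.lattice
    · obtain ⟨g, hg, e⟩ := removable_comp (φ := fun z => -(z + y)) (by fun_prop)
        (fun a b h => by simpa using h) (shift (-(z + y)) (neg_mem hzy))
      refine ⟨-g, hg.neg, ?_⟩
      filter_upwards [e] with w hw
      rw [Pi.neg_apply, ← hw, Function.comp_apply, L.addDet_neg_add, neg_neg]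
    · exact ⟨_, L.analyticAt_addDet hz hzy, EventuallyEq.rfl⟩
  have hx' : -(x + y) ∉ L.lattice := by rwa [neg_mem_iff]
  have hxy' : -(x + y) + y ∉ L.lattice := by
    rwa [show -(x + y) + y = -x by ring, neg_mem_iff]
  have := L.eq_of_periodic_of_removable (fun z l hl => L.addDet_add_period y z hl) hrem
    (L.analyticAt_addDet hx hxy).continuousAt (L.analyticAt_addDet hx' hxy').continuousAt
  rw [addDet_neg_add] at this
  linear_combination this / 2

end PeriodPair

/-! ### Weierstrass functions of lattices of index two. -/

namespace PeriodPair
open Set Filter Topology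

theorem countable_lattice (L : PeriodPair) : (L.lattice : Set ℂ).Countable :=
  Set.countable_coe_iff.1 (L.latticeEquivProd.toEquiv.countable_iff.2 inferInstance)

/-- The value of `℘` for a lattice that contains `L` with index two. -/
theorem weierstrassP_of_index_two {L M : PeriodPair} {ω : ℂ} (hω : ω ∉ L.lattice)
    (hM : ∀ z, z ∈ M.lattice ↔ z ∈ L.lattice ∨ z - ω ∈ L.lattice) :
    ∃ e : ℂ, ∀ z, z ∉ M.lattice →
      M.weierstrassP z = L.weierstrassP z + L.weierstrassP (z - ω) + e := by
  -- The comparison is made for `℘'`, whose series has no correction terms: the sum over `M` splits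
  -- over the two cosets of `L`, and the sum over the coset of `ω` is the series for `L` at `z - ω`.
  have hderiv : ∀ z, M.derivWeierstrassP z
      = L.derivWeierstrassP z + L.derivWeierstrassP (z - ω) := by
    intro z
    let F : ℂ → ℂ := fun l => -2 / (z - l) ^ 3
    let t : Set ℂ := {l | l - ω ∈ L.lattice}
    have hdisj : Disjoint (L.lattice : Set ℂ) t := by
      rw [Set.disjoint_left]
      intro l hl hlt
      exact hω (by simpa using L.lattice.sub_mem hl hlt)
    have hunion : (M.lattice : Set ℂ) = (L.lattice : Set ℂ) ∪ t := by
      ext z; exact hM z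
    have h1 : HasSum (F ∘ ((↑) : ↥(L.lattice : Set ℂ) → ℂ)) (L.derivWeierstrassP z) :=
      L.hasSum_derivWeierstrassP z
    let e : t ≃ ↥(L.lattice : Set ℂ) :=
      { toFun := fun l => ⟨l - ω, l.2⟩
        invFun := fun l => ⟨l + ω, by simp [t]⟩
        left_inv := fun l => by simp
        right_inv := fun l => by simp }
    have h2 : HasSum (F ∘ ((↑) : t → ℂ)) (L.derivWeierstrassP (z - ω)) := by
      have := (e.hasSum_iff).2 (L.hasSum_derivWeierstrassP (z - ω))
      convert! this using 1
      ext l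
      simp [F, e]
    have h3 := h1.add_disjoint hdisj h2
    rw [← hunion] at h3
    exact (M.hasSum_derivWeierstrassP z).unique h3
  -- The complement of a countable subset of the plane is connected, so a zero derivative there
  -- gives one and the same constant everywhere.
  have hconn : IsPreconnected ((M.lattice : Set ℂ)ᶜ) :=
    (M.countable_lattice.isPathConnected_compl_of_one_lt_rank (by simp)).isConnected.isPreconnected
  have hopen : IsOpen ((M.lattice : Set ℂ)ᶜ) := M.isClosed_lattice.isOpen_compl
  let G : ℂ → ℂ := fun z => M.weierstrassP z - (L.weierstrassP z + L.weierstrassP (z - ω))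
  have hG : ∀ z ∈ (M.lattice : Set ℂ)ᶜ, HasDerivAt G 0 z := by
    intro z hz
    have hz' : z ∉ L.lattice ∧ z - ω ∉ L.lattice := by
      rw [← not_or, ← hM]; exact hz
    have := (M.hasDerivAt_weierstrassP hz).sub ((L.hasDerivAt_weierstrassP hz'.1).add
      ((L.hasDerivAt_weierstrassP hz'.2).comp_sub_const z ω))
    rwa [hderiv, sub_self] at this
  obtain ⟨e, he⟩ := hopen.exists_is_const_of_deriv_eq_zero hconn
    (fun z hz => (hG z hz).differentiableAt.differentiableWithinAt)
    (fun z hz => (hG z hz).deriv)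
  refine ⟨e, fun z hz => ?_⟩
  have := he z hz
  simp only [G] at this
  linear_combination this

end PeriodPair

/-! ### Building solutions of the first order system. -/

namespace TypeB2
open Set Filter Topology
namespace Compatible

/-- The system contains `v'` and `w'`, so these functions must be compared as germs. This form suits
identities between potentials that hold only off the singularities. -/
theorem congr {Ω : Set (ℂ × ℂ)} (hΩ : IsOpen Ω) {uM uP v w v' w' : ℂ → ℂ} {T T' : ℂ → ℂ → ℂ}
    (h : Compatible Ω uM uP v w T) (hv : ∀ p ∈ Ω, v =ᶠ[𝓝 p.1] v')
    (hw : ∀ p ∈ Ω, w =ᶠ[𝓝 p.2] w') (hT : ∀ p ∈ Ω, T p.1 p.2 = T' p.1 p.2) :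
    Compatible Ω uM uP v' w' T' where
  uM_an := h.uM_an
  uP_an := h.uP_an
  v_an p hp := (h.v_an p hp).congr (hv p hp)
  w_an p hp := (h.w_an p hp).congr (hw p hp)
  T_an := analyticOnNhd_congr hΩ h.T_an hT
  T_x p hp := by
    rw [← (hw p hp).deriv_eq, ← (hw p hp).eq_of_nhds, ← h.T_x p hp]
    exact (dX_congr hΩ (f := fun p => T p.1 p.2) (g := fun p => T' p.1 p.2) hT hp).symm
  T_y p hp := by
    rw [← (hv p hp).deriv_eq, ← (hv p hp).eq_of_nhds, ← h.T_y p hp]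
    exact (dY_congr hΩ (f := fun p => T p.1 p.2) (g := fun p => T' p.1 p.2) hT hp).symm

variable {Ω : Set (ℂ × ℂ)} {uM uP v w uM₀ uP₀ v₀ w₀ uM₁ uP₁ v₁ w₁ : ℂ → ℂ}
  {T T₀ T₁ : ℂ → ℂ → ℂ}

theorem differentiableAt_fst (h : Compatible Ω uM uP v w T) {p : ℂ × ℂ} (hp : p ∈ Ω) :
    DifferentiableAt ℂ (fun s => T s p.2) p.1 :=
  (hasDerivAt_slice_fst (h.T_an p hp).differentiableAt).differentiableAt

theorem differentiableAt_snd (h : Compatible Ω uM uP v w T) {p : ℂ × ℂ} (hp : p ∈ Ω) :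
    DifferentiableAt ℂ (fun s => T p.1 s) p.2 :=
  (hasDerivAt_slice_snd (h.T_an p hp).differentiableAt).differentiableAt

/-- For fixed `(u⁻, u⁺)` both equations are linear in `(v, w, T)` jointly; `linear_u` is the same
observation with the roles exchanged. -/
theorem linear_v (C₀ C₁ : ℂ) (h₀ : Compatible Ω uM uP v₀ w₀ T₀)
    (h₁ : Compatible Ω uM uP v₁ w₁ T₁) :
    Compatible Ω uM uP (fun t => C₀ * v₀ t + C₁ * v₁ t) (fun t => C₀ * w₀ t + C₁ * w₁ t)
      (fun x y => C₀ * T₀ x y + C₁ * T₁ x y) where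
  uM_an := h₀.uM_an
  uP_an := h₀.uP_an
  v_an p hp := (analyticAt_const.mul (h₀.v_an p hp)).add (analyticAt_const.mul (h₁.v_an p hp))
  w_an p hp := (analyticAt_const.mul (h₀.w_an p hp)).add (analyticAt_const.mul (h₁.w_an p hp))
  T_an p hp := (analyticAt_const.mul (h₀.T_an p hp)).add (analyticAt_const.mul (h₁.T_an p hp))
  T_x p hp := by
    have e := (((h₀.differentiableAt_fst hp).hasDerivAt.const_mul C₀).add
      ((h₁.differentiableAt_fst hp).hasDerivAt.const_mul C₁)).deriv
    have e' := (((h₀.w_an p hp).differentiableAt.hasDerivAt.const_mul C₀).add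
      ((h₁.w_an p hp).differentiableAt.hasDerivAt.const_mul C₁)).deriv
    refine e.trans ?_
    erw [e', h₀.T_x p hp, h₁.T_x p hp]
    ring
  T_y p hp := by
    have e := (((h₀.differentiableAt_snd hp).hasDerivAt.const_mul C₀).add
      ((h₁.differentiableAt_snd hp).hasDerivAt.const_mul C₁)).deriv
    have e' := (((h₀.v_an p hp).differentiableAt.hasDerivAt.const_mul C₀).add
      ((h₁.v_an p hp).differentiableAt.hasDerivAt.const_mul C₁)).deriv
    refine e.trans ?_
    erw [e', h₀.T_y p hp, h₁.T_y p hp]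
    ring

theorem linear_u (A₀ A₁ : ℂ) (h₀ : Compatible Ω uM₀ uP₀ v w T₀)
    (h₁ : Compatible Ω uM₁ uP₁ v w T₁) :
    Compatible Ω (fun t => A₀ * uM₀ t + A₁ * uM₁ t) (fun t => A₀ * uP₀ t + A₁ * uP₁ t) v w
      (fun x y => A₀ * T₀ x y + A₁ * T₁ x y) where
  uM_an p hp := (analyticAt_const.mul (h₀.uM_an p hp)).add (analyticAt_const.mul (h₁.uM_an p hp))
  uP_an p hp := (analyticAt_const.mul (h₀.uP_an p hp)).add (analyticAt_const.mul (h₁.uP_an p hp))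
  v_an := h₀.v_an
  w_an := h₀.w_an
  T_an p hp := (analyticAt_const.mul (h₀.T_an p hp)).add (analyticAt_const.mul (h₁.T_an p hp))
  T_x p hp := by
    have e := (((h₀.differentiableAt_fst hp).hasDerivAt.const_mul A₀).add
      ((h₁.differentiableAt_fst hp).hasDerivAt.const_mul A₁)).deriv
    have eM := (((h₀.uM_an p hp).differentiableAt.hasDerivAt.const_mul A₀).add
      ((h₁.uM_an p hp).differentiableAt.hasDerivAt.const_mul A₁)).deriv
    have eP := (((h₀.uP_an p hp).differentiableAt.hasDerivAt.const_mul A₀).add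
      ((h₁.uP_an p hp).differentiableAt.hasDerivAt.const_mul A₁)).deriv
    refine e.trans ?_
    erw [eM, eP, h₀.T_x p hp, h₁.T_x p hp]
    ring
  T_y p hp := by
    have e := (((h₀.differentiableAt_snd hp).hasDerivAt.const_mul A₀).add
      ((h₁.differentiableAt_snd hp).hasDerivAt.const_mul A₁)).deriv
    have eM := (((h₀.uM_an p hp).differentiableAt.hasDerivAt.const_mul A₀).add
      ((h₁.uM_an p hp).differentiableAt.hasDerivAt.const_mul A₁)).deriv
    have eP := (((h₀.uP_an p hp).differentiableAt.hasDerivAt.const_mul A₀).add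
      ((h₁.uP_an p hp).differentiableAt.hasDerivAt.const_mul A₁)).deriv
    refine e.trans ?_
    erw [eM, eP, h₀.T_y p hp, h₁.T_y p hp]
    ring

/-- The case of even `u⁺ = u⁻` and `v = w`, in terms of `F = T - 2 (u⁺ + u⁻) (v + w)`. -/
theorem of_symm {Ω : Set (ℂ × ℂ)} {Du Dv : Set ℂ} {u u' v v' : ℂ → ℂ} {F : ℂ → ℂ → ℂ}
    (hΩ : ∀ p ∈ Ω, p.1 - p.2 ∈ Du ∧ p.1 + p.2 ∈ Du ∧ p.1 ∈ Dv ∧ p.2 ∈ Dv)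
    (hswap : ∀ p ∈ Ω, p.swap ∈ Ω)
    (hu : ∀ t ∈ Du, AnalyticAt ℂ u t) (hv : ∀ t ∈ Dv, AnalyticAt ℂ v t)
    (hu' : ∀ t ∈ Du, HasDerivAt u (u' t) t) (hv' : ∀ t ∈ Dv, HasDerivAt v (v' t) t)
    (ueven : ∀ t, u (-t) = u t) (uodd : ∀ t, u' (-t) = -u' t)
    (hF : AnalyticOnNhd ℂ (fun p : ℂ × ℂ => F p.1 p.2) Ω) (hFsymm : ∀ x y, F x y = F y x)
    (hFx : ∀ x y, (x, y) ∈ Ω → deriv (fun s => F s y) x =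
      2 * (u' (x + y) + u' (x - y)) * (v y - v x) - 2 * (u (x + y) + u (x - y)) * v' x
        - 2 * v' y * (u (x - y) - u (x + y))) :
    Compatible Ω u u v v (fun x y => 2 * (u (x - y) + u (x + y)) * (v x + v y) + F x y) := by
  have hTx : ∀ x y, (x, y) ∈ Ω →
      deriv (fun s => 2 * (u (s - y) + u (s + y)) * (v s + v y) + F s y) x =
      4 * v y * (u' (x + y) + u' (x - y)) - 2 * v' y * (u (x - y) - u (x + y)) := by
    intro x y hp
    obtain ⟨h1, h2, h3, h4⟩ := hΩ _ hp
    have hFd := (hasDerivAt_slice_fst (hF _ hp).differentiableAt).differentiableAt.hasDerivAt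
    have := (((((hu' _ h1).comp_sub_const x y).add ((hu' _ h2).comp_add_const x y)).const_mul
      2).mul ((hv' _ h3).add_const (v y))).add hFd
    refine this.deriv.trans ?_
    simp only [hFx x y hp, Pi.add_apply]
    ring
  exact
  { uM_an := fun p hp => hu _ (hΩ p hp).1
    uP_an := fun p hp => hu _ (hΩ p hp).2.1
    v_an := fun p hp => hv _ (hΩ p hp).2.2.1
    w_an := fun p hp => hv _ (hΩ p hp).2.2.2
    T_an := fun p hp =>
      ((analyticAt_const.mul
        (((hu _ (hΩ p hp).1).fun_comp (f := fun p : ℂ × ℂ => p.1 - p.2)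
          (analyticAt_fst.sub analyticAt_snd)).add
        ((hu _ (hΩ p hp).2.1).fun_comp (f := fun p : ℂ × ℂ => p.1 + p.2)
          (analyticAt_fst.add analyticAt_snd)))).mul
        (((hv _ (hΩ p hp).2.2.1).fun_comp (f := fun p : ℂ × ℂ => p.1) analyticAt_fst).add
        ((hv _ (hΩ p hp).2.2.2).fun_comp (f := fun p : ℂ × ℂ => p.2) analyticAt_snd))).add
        (hF p hp)
    T_x := fun p hp => by
      rw [hTx p.1 p.2 hp, (hu' _ (hΩ p hp).1).deriv, (hu' _ (hΩ p hp).2.1).deriv,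
        (hv' _ (hΩ p hp).2.2.2).deriv]
    T_y := fun p hp => by
      -- As `u` is even and `F` symmetric, `T` is symmetric, so the equation for `T_y` at `(x, y)`
      -- is the one for `T_x` at `(y, x)`, up to the parity of `u` and `u'`.
      have h := hTx p.2 p.1 (hswap p hp)
      rw [(hu' _ (hΩ p hp).1).deriv, (hu' _ (hΩ p hp).2.1).deriv,
        (hv' _ (hΩ p hp).2.2.1).deriv]
      have e : ∀ s, u (p.1 - s) = u (s - p.1) := fun s => by rw [← ueven, neg_sub]
      have e' : u' (p.1 - p.2) = -u' (p.2 - p.1) := by rw [← uodd, neg_sub]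
      simp only [e, e', add_comm p.1, add_comm (v p.1), hFsymm p.1]
      rw [h]
      ring }

/-- When `v' = w' = 0` the system says that the gradient of `T` is `4c` times that of `q`. This
solution absorbs the additive constants in the relations between Weierstrass functions. -/
theorem const_v {Ω : Set (ℂ × ℂ)} {u : ℂ → ℂ} (c : ℂ)
    (h1 : ∀ p ∈ Ω, AnalyticAt ℂ u (p.1 - p.2)) (h2 : ∀ p ∈ Ω, AnalyticAt ℂ u (p.1 + p.2)) :
    Compatible Ω u u (fun _ => c) (fun _ => c) (fun x y => 4 * c * (u (x - y) + u (x + y))) where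
  uM_an := h1
  uP_an := h2
  v_an _ _ := analyticAt_const
  w_an _ _ := analyticAt_const
  T_an p hp := analyticAt_const.mul (((h1 p hp).fun_comp (f := fun p : ℂ × ℂ => p.1 - p.2)
          (analyticAt_fst.sub analyticAt_snd)).add
        ((h2 p hp).fun_comp (f := fun p : ℂ × ℂ => p.1 + p.2)
          (analyticAt_fst.add analyticAt_snd)))
  T_x p hp := by
    refine (((((h1 p hp).differentiableAt.hasDerivAt.comp_sub_const p.1 p.2).add
      ((h2 p hp).differentiableAt.hasDerivAt.comp_add_const p.1 p.2)).const_mul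
      (4 * c)).deriv).trans ?_
    simp only [deriv_const]
    ring
  T_y p hp := by
    refine (((((h1 p hp).differentiableAt.hasDerivAt.comp_const_sub p.1 p.2).add
      ((h2 p hp).differentiableAt.hasDerivAt.comp_const_add p.1 p.2)).const_mul
      (4 * c)).deriv).trans ?_
    simp only [deriv_const]
    ring

/-- The basic solution attached to an even function with an addition theorem. -/
theorem of_addition {Ω : Set (ℂ × ℂ)} {S : Set ℂ} {p p' : ℂ → ℂ} (ω : ℂ)
    (hΩ : ∀ z ∈ Ω, z.1 - z.2 ∉ S ∧ z.1 + z.2 ∉ S ∧ z.1 + ω ∉ S ∧ z.2 + ω ∉ S)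
    (hswap : ∀ z ∈ Ω, z.swap ∈ Ω) (hp : ∀ t ∉ S, AnalyticAt ℂ p t)
    (hp' : ∀ t ∉ S, HasDerivAt p (p' t) t) (hS : ∀ t ∉ S, -t ∉ S)
    (heven : ∀ t, p (-t) = p t) (hodd : ∀ t, p' (-t) = -p' t)
    (hSω : ∀ t, t ∉ S → t + 2 * ω ∉ S)
    (hpω : ∀ t, p (t + 2 * ω) = p t) (hpω' : ∀ t, p' (t + 2 * ω) = p' t)
    (hadd : ∀ x y, x ∉ S → y ∉ S → x + y ∉ S →
      p' (x + y) * (p x - p y) + p (x + y) * (p' x - p' y) + p x * p' y - p' x * p y = 0) :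
    Compatible Ω p p (fun t => p (t + ω)) (fun t => p (t + ω))
      (fun x y => 2 * (p (x - y) + p (x + y)) * (p (x + ω) + p (y + ω))
        + -4 * (p (x + ω) * p (y + ω))) := by
  refine of_symm (Du := Sᶜ) (Dv := {t | t + ω ∉ S}) (u' := p') (v' := fun t => p' (t + ω))
    (F := fun x y => -4 * (p (x + ω) * p (y + ω))) hΩ hswap hp
    (fun t ht => (hp _ ht).fun_comp (f := fun t => t + ω) (by fun_prop)) hp'
    (fun t ht => (hp' _ ht).comp_add_const t ω) heven hodd (fun z hz => ?_) (fun x y => by ring)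
    (fun x y hz => ?_)
  · obtain ⟨-, -, h3, h4⟩ := hΩ z hz
    exact analyticAt_const.mul (((hp _ h3).fun_comp (f := fun z : ℂ × ℂ => z.1 + ω)
      (analyticAt_fst.add analyticAt_const)).mul ((hp _ h4).fun_comp
      (f := fun z : ℂ × ℂ => z.2 + ω) (analyticAt_snd.add analyticAt_const)))
  · obtain ⟨h1, h2, h3, h4⟩ := hΩ _ hz
    refine (((((hp' _ h3).comp_add_const x ω).mul_const (p (y + ω))).const_mul
      (-4)).deriv).trans ?_
    -- The two sums are `x + y` up to the period `2ω`, and `x - y`, so the two instances of the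
    -- addition theorem involve exactly `p(x ± y)`. Evenness of `p` lets the same value `p(y + ω)`
    -- serve in both.
    have e1 : (x + ω) + (y + ω) = (x + y) + 2 * ω := by ring
    have e2 : (x + ω) + -(y + ω) = x - y := by ring
    have a1 := hadd (x + ω) (y + ω) h3 h4 (by rw [e1]; exact hSω _ h2)
    have a2 := hadd (x + ω) (-(y + ω)) h3 (hS _ h4) (by rwa [e2])
    rw [e1, hpω, hpω'] at a1
    rw [e2, heven, hodd] at a2
    linear_combination 2 * a1 + 2 * a2

end Compatible
end TypeB2

/-! ### The elliptic family. -/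

namespace TypeB2
open Set Filter Topology

theorem Compatible.weierstrass (M : PeriodPair) {Ω : Set (ℂ × ℂ)} {ω : ℂ}
    (hω : 2 * ω ∈ M.lattice)
    (hΩ : ∀ z ∈ Ω, z.1 - z.2 ∉ M.lattice ∧ z.1 + z.2 ∉ M.lattice ∧ z.1 + ω ∉ M.lattice ∧
      z.2 + ω ∉ M.lattice) (hswap : ∀ z ∈ Ω, z.swap ∈ Ω) :
    Compatible Ω M.weierstrassP M.weierstrassP
      (fun t => M.weierstrassP (t + ω)) (fun t => M.weierstrassP (t + ω))
      (fun x y => 2 * (M.weierstrassP (x - y) + M.weierstrassP (x + y))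
        * (M.weierstrassP (x + ω) + M.weierstrassP (y + ω))
        + -4 * (M.weierstrassP (x + ω) * M.weierstrassP (y + ω))) :=
  Compatible.of_addition (S := M.lattice) (p' := M.derivWeierstrassP) ω hΩ hswap
    (fun _ ht => M.analyticAt_weierstrassP ht) (fun _ ht => M.hasDerivAt_weierstrassP ht)
    (fun _ ht h => ht (by simpa using neg_mem h)) M.weierstrassP_neg M.derivWeierstrassP_neg
    (fun _ ht h => ht (by simpa using sub_mem h hω))
    (fun t => M.weierstrassP_add_coe t ⟨_, hω⟩) (fun t => M.derivWeierstrassP_add_coe t ⟨_, hω⟩)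
    (fun _ _ hx hy hxy => M.addDet_eq_zero hx hy hxy)

section Elliptic
variable (L : PeriodPair)

/-- The lattice `ℤ 2ω₁ + ℤ 2ω₂`. -/
abbrev L22 : PeriodPair := scale L 2 2 two_ne_zero two_ne_zero

/-- The lattice `ℤ ω₁ + ℤ 2ω₂`. -/
abbrev L12 : PeriodPair := scale L 1 2 one_ne_zero two_ne_zero

theorem mem_L22 {z : ℂ} : z ∈ (L22 L).lattice ↔
    ∃ m n : ℤ, (2 * m : ℤ) * L.ω₁ + (2 * n : ℤ) * L.ω₂ = z := by
  rw [PeriodPair.mem_lattice]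
  simp only [scale]
  push_cast
  simp only [mul_left_comm (_ : ℂ) 2, mul_assoc]

theorem mem_L12 {z : ℂ} : z ∈ (L12 L).lattice ↔
    ∃ m n : ℤ, (m : ℤ) * L.ω₁ + (2 * n : ℤ) * L.ω₂ = z := by
  rw [PeriodPair.mem_lattice]
  simp only [scale]
  push_cast
  simp only [mul_left_comm (_ : ℂ) 2, mul_assoc, one_mul]

theorem mem_L12_iff (z : ℂ) :
    z ∈ (L12 L).lattice ↔ z ∈ (L22 L).lattice ∨ z - L.ω₁ ∈ (L22 L).lattice := by
  simp only [mem_L12, mem_L22]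
  constructor
  · rintro ⟨m, n, rfl⟩
    obtain ⟨k, rfl | rfl⟩ := m.even_or_odd'
    · exact Or.inl ⟨k, n, rfl⟩
    · exact Or.inr ⟨k, n, by push_cast; ring⟩
  · rintro (⟨m, n, rfl⟩ | ⟨m, n, h⟩)
    · exact ⟨2 * m, n, rfl⟩
    · exact ⟨2 * m + 1, n, by push_cast at h ⊢; linear_combination h⟩

theorem mem_lattice_iff (z : ℂ) :
    z ∈ L.lattice ↔ z ∈ (L12 L).lattice ∨ z - L.ω₂ ∈ (L12 L).lattice := by
  rw [PeriodPair.mem_lattice]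
  simp only [mem_L12]
  constructor
  · rintro ⟨m, n, rfl⟩
    obtain ⟨k, rfl | rfl⟩ := n.even_or_odd'
    · exact Or.inl ⟨m, k, rfl⟩
    · exact Or.inr ⟨m, k, by push_cast; ring⟩
  · rintro (⟨m, n, rfl⟩ | ⟨m, n, h⟩)
    · exact ⟨m, 2 * n, rfl⟩
    · exact ⟨m, 2 * n + 1, by push_cast at h ⊢; linear_combination h⟩

theorem L22_le {z : ℂ} (h : z ∈ (L22 L).lattice) : z ∈ (L12 L).lattice :=
  (mem_L12_iff L z).2 (Or.inl h)

theorem L12_le {z : ℂ} (h : z ∈ (L12 L).lattice) : z ∈ L.lattice :=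
  (mem_lattice_iff L z).2 (Or.inl h)

theorem two_mul_om_mem (j : Fin 4) : 2 * om L j ∈ (L22 L).lattice := by
  rw [mem_L22]
  fin_cases j
  · exact ⟨0, 0, by simp [om]⟩
  · exact ⟨1, 0, by simp [om]⟩
  · exact ⟨0, 1, by simp [om]⟩
  · exact ⟨-1, -1, by simp [om]; ring⟩

theorem om_mem (j : Fin 4) : om L j ∈ L.lattice := by
  rw [PeriodPair.mem_lattice]
  fin_cases j
  · exact ⟨0, 0, by simp [om]⟩
  · exact ⟨1, 0, by simp [om]⟩
  · exact ⟨0, 1, by simp [om]⟩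
  · exact ⟨-1, -1, by simp [om]; ring⟩

theorem wp12_eq : ∃ e : ℂ, ∀ z, z ∉ (L12 L).lattice →
    wp12 L z = wp22 L (z + om L 0) + wp22 L (z + om L 1) + e := by
  obtain ⟨e, he⟩ := PeriodPair.weierstrassP_of_index_two (L := L22 L) (M := L12 L) (ω := L.ω₁)
    (by simpa [scale] using (L22 L).ω₁_div_two_notMem_lattice) (mem_L12_iff L)
  refine ⟨e, fun z hz => ?_⟩
  -- Since `2ω₁` is a period of `L22`, the translate by `-ω₁` equals the translate by `ω₁`.
  have h := (L22 L).weierstrassP_add_coe (z - L.ω₁) ⟨_, two_mul_om_mem L 1⟩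
  have e1 : z - L.ω₁ + 2 * om L 1 = z + om L 1 := by simp [om]; ring
  have e0 : z + om L 0 = z := by simp [om]
  simp only [e1] at h
  rw [e0, wp12, wp22, h]
  exact he z hz

theorem wp11_eq : ∃ e : ℂ, ∀ z, z ∉ L.lattice →
    wp11 L z = wp12 L (z + om L 0) + wp12 L (z + om L 2) + e := by
  obtain ⟨e, he⟩ := PeriodPair.weierstrassP_of_index_two (L := L12 L) (M := L) (ω := L.ω₂)
    (by simpa [scale] using (L12 L).ω₂_div_two_notMem_lattice) (mem_lattice_iff L)
  refine ⟨e, fun z hz => ?_⟩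
  have h := (L12 L).weierstrassP_add_coe (z - L.ω₂) ⟨_, L22_le L (two_mul_om_mem L 2)⟩
  have e1 : z - L.ω₂ + 2 * om L 2 = z + om L 2 := by simp [om]; ring
  have e0 : z + om L 0 = z := by simp [om]
  simp only [e1] at h
  rw [e0, wp11, wp12, h]
  exact he z hz

/-- Two successive index two steps; the point `ω₁ + ω₂` is replaced by `ω₃ = -ω₁ - ω₂`, which
differs from it by a period of `L22`. -/
theorem wp11_eq_sum : ∃ e : ℂ, ∀ z, z ∉ L.lattice →
    wp11 L z = wp22 L (z + om L 0) + wp22 L (z + om L 1) + wp22 L (z + om L 2)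
      + wp22 L (z + om L 3) + e := by
  obtain ⟨e₀, h₀⟩ := wp12_eq L
  obtain ⟨e₁, h₁⟩ := wp11_eq L
  refine ⟨e₀ + e₀ + e₁, fun z hz => ?_⟩
  have hj : ∀ j, z + om L j ∉ (L12 L).lattice := fun j h =>
    hz (by simpa using sub_mem (L12_le L h) (om_mem L j))
  rw [h₁ z hz, h₀ _ (hj 0), h₀ _ (hj 2)]
  have h := (L22 L).weierstrassP_sub_coe (z + om L 2 + om L 1)
    ⟨2 * om L 1 + 2 * om L 2, add_mem (two_mul_om_mem L 1) (two_mul_om_mem L 2)⟩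
  have e1 : z + om L 2 + om L 1 - (2 * om L 1 + 2 * om L 2) = z + om L 3 := by simp [om]; ring
  simp only [e1] at h
  have e0 : ∀ z, z + om L 0 = z := by simp [om]
  simp only [e0]
  rw [show wp22 L (z + om L 2 + om L 1) = wp22 L (z + om L 3) from h.symm]
  ring

/-- The set on which the elliptic system is considered. -/
def ellΩ : Set (ℂ × ℂ) := {p | p.1 - p.2 ∉ (L12 L).lattice ∧ p.1 + p.2 ∉ (L12 L).lattice ∧
  p.1 ∉ L.lattice ∧ p.2 ∉ L.lattice}

theorem isOpen_ellΩ : IsOpen (ellΩ L) := by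
  have h1 := (L12 L).isClosed_lattice.isOpen_compl
  have h2 := L.isClosed_lattice.isOpen_compl
  exact (h1.preimage (continuous_fst.sub continuous_snd)).inter
    ((h1.preimage (continuous_fst.add continuous_snd)).inter
      ((h2.preimage continuous_fst).inter (h2.preimage continuous_snd)))

theorem swap_mem_ellΩ : ∀ z ∈ ellΩ L, z.swap ∈ ellΩ L := by
  rintro ⟨x, y⟩ ⟨h1, h2, h3, h4⟩
  refine ⟨fun h => h1 ?_, by rwa [add_comm] at h2, h4, h3⟩
  simpa using neg_mem h

theorem add_om_notMem {z : ℂ} (hz : z ∉ L.lattice) (j : Fin 4) : z + om L j ∉ (L12 L).lattice :=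
  fun h => hz (by simpa using sub_mem (L12_le L h) (om_mem L j))

theorem compatible_wp22 (j : Fin 4) :
    Compatible (ellΩ L) (wp22 L) (wp22 L) (fun t => wp22 L (t + om L j))
      (fun t => wp22 L (t + om L j))
      (fun x y => 2 * (wp22 L (x - y) + wp22 L (x + y)) * (wp22 L (x + om L j) + wp22 L (y + om L j))
        + -4 * (wp22 L (x + om L j) * wp22 L (y + om L j))) :=
  Compatible.weierstrass (L22 L) (two_mul_om_mem L j)
    (fun _ hz => ⟨fun h => hz.1 (L22_le L h), fun h => hz.2.1 (L22_le L h),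
      fun h => add_om_notMem L hz.2.2.1 j (L22_le L h),
      fun h => add_om_notMem L hz.2.2.2 j (L22_le L h)⟩) (swap_mem_ellΩ L)

theorem compatible_wp12 (j : Fin 4) :
    Compatible (ellΩ L) (wp12 L) (wp12 L) (fun t => wp12 L (t + om L j))
      (fun t => wp12 L (t + om L j))
      (fun x y => 2 * (wp12 L (x - y) + wp12 L (x + y)) * (wp12 L (x + om L j) + wp12 L (y + om L j))
        + -4 * (wp12 L (x + om L j) * wp12 L (y + om L j))) :=
  Compatible.weierstrass (L12 L) (L22_le L (two_mul_om_mem L j))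
    (fun _ hz => ⟨hz.1, hz.2.1, add_om_notMem L hz.2.2.1 j, add_om_notMem L hz.2.2.2 j⟩)
    (swap_mem_ellΩ L)

theorem compatible_wp22_wp12 : Compatible (ellΩ L) (wp22 L) (wp22 L) (wp12 L) (wp12 L)
    (fun x y => 2 * (wp22 L (x - y) + wp22 L (x + y)) * (wp12 L x + wp12 L y)
      - 4 * (wp22 L (x + om L 0) * wp22 L (y + om L 0)
        + wp22 L (x + om L 1) * wp22 L (y + om L 1))) := by
  obtain ⟨e, he⟩ := wp12_eq L
  -- The sum of the solutions for the half periods `ω₀`, `ω₁` has `v = wp12 - e`. The constant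
  -- solution adds `4e (u(x-y) + u(x+y))` to `T`, exactly what turns its `v(x) + v(y)` into `wp12 L
  -- x + wp12 L y`.
  have h := Compatible.linear_v 1 1
    (Compatible.linear_v 1 1 (compatible_wp22 L 0) (compatible_wp22 L 1))
    (Compatible.const_v e (compatible_wp22 L 0).uM_an (compatible_wp22 L 0).uP_an)
  have hev : ∀ z ∉ L.lattice, (fun t => 1 * (1 * wp22 L (t + om L 0) + 1 * wp22 L (t + om L 1))
      + 1 * e) =ᶠ[𝓝 z] wp12 L := by
    intro z hz
    filter_upwards [L.eventually_notMem_lattice continuousAt_id hz] with t ht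
    rw [he t fun h => ht (L12_le L h)]
    ring
  refine h.congr (isOpen_ellΩ L) (fun p hp => hev _ hp.2.2.1) (fun p hp => hev _ hp.2.2.2)
    fun p hp => ?_
  rw [← (hev _ hp.2.2.1).eq_of_nhds, ← (hev _ hp.2.2.2).eq_of_nhds]
  ring

theorem compatible_wp22_wp11 : Compatible (ellΩ L) (wp22 L) (wp22 L) (wp11 L) (wp11 L)
    (fun x y => 2 * (wp22 L (x - y) + wp22 L (x + y)) * (wp11 L x + wp11 L y)
      - 4 * ∑ j : Fin 4, wp22 L (x + om L j) * wp22 L (y + om L j)) := by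
  obtain ⟨e, he⟩ := wp11_eq_sum L
  have h := Compatible.linear_v 1 1
    (Compatible.linear_v 1 1
      (Compatible.linear_v 1 1 (compatible_wp22 L 0) (compatible_wp22 L 1))
      (Compatible.linear_v 1 1 (compatible_wp22 L 2) (compatible_wp22 L 3)))
    (Compatible.const_v e (compatible_wp22 L 0).uM_an (compatible_wp22 L 0).uP_an)
  have hev : ∀ z ∉ L.lattice, (fun t => 1 * (1 * (1 * wp22 L (t + om L 0) + 1 * wp22 L (t + om L 1))
      + 1 * (1 * wp22 L (t + om L 2) + 1 * wp22 L (t + om L 3))) + 1 * e) =ᶠ[𝓝 z] wp11 L := by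
    intro z hz
    filter_upwards [L.eventually_notMem_lattice continuousAt_id hz] with t ht
    rw [he t ht]
    ring
  refine h.congr (isOpen_ellΩ L) (fun p hp => hev _ hp.2.2.1) (fun p hp => hev _ hp.2.2.2)
    fun p hp => ?_
  rw [← (hev _ hp.2.2.1).eq_of_nhds, ← (hev _ hp.2.2.2).eq_of_nhds, Fin.sum_univ_four]
  ring

theorem compatible_wp12_wp12 : Compatible (ellΩ L) (wp12 L) (wp12 L) (wp12 L) (wp12 L)
    (fun x y => 2 * (wp12 L (x - y) + wp12 L (x + y)) * (wp12 L x + wp12 L y)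
      - 4 * (wp12 L x * wp12 L y)) := by
  have h := compatible_wp12 L 0
  have e0 : ∀ z, z + om L 0 = z := by simp [om]
  simp only [e0] at h
  exact h.congr (isOpen_ellΩ L) (fun _ _ => .rfl) (fun _ _ => .rfl) fun p _ => by ring

theorem compatible_wp12_wp11 : Compatible (ellΩ L) (wp12 L) (wp12 L) (wp11 L) (wp11 L)
    (fun x y => 2 * (wp12 L (x - y) + wp12 L (x + y)) * (wp11 L x + wp11 L y)
      - 4 * (wp12 L (x + om L 0) * wp12 L (y + om L 0)
        + wp12 L (x + om L 2) * wp12 L (y + om L 2))) := by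
  obtain ⟨e, he⟩ := wp11_eq L
  have h := Compatible.linear_v 1 1
    (Compatible.linear_v 1 1 (compatible_wp12 L 0) (compatible_wp12 L 2))
    (Compatible.const_v e (compatible_wp12 L 0).uM_an (compatible_wp12 L 0).uP_an)
  have hev : ∀ z ∉ L.lattice, (fun t => 1 * (1 * wp12 L (t + om L 0) + 1 * wp12 L (t + om L 2))
      + 1 * e) =ᶠ[𝓝 z] wp11 L := by
    intro z hz
    filter_upwards [L.eventually_notMem_lattice continuousAt_id hz] with t ht
    rw [he t ht]
    ring
  refine h.congr (isOpen_ellΩ L) (fun p hp => hev _ hp.2.2.1) (fun p hp => hev _ hp.2.2.2)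
    fun p hp => ?_
  rw [← (hev _ hp.2.2.1).eq_of_nhds, ← (hev _ hp.2.2.2).eq_of_nhds]
  ring

theorem isCommuting_ellipB2S (A₀ A₁ C₀ C₁ : ℂ) : (ellipB2S L A₀ A₁ C₀ C₁).IsCommuting := by
  refine System.isCommuting_of_compatible _ (isOpen_ellΩ L) (fun x y _ => ?_) ?_
  · simp only [ellipB2S]; ring
  · refine (Compatible.linear_u A₀ A₁
      (Compatible.linear_v C₀ C₁ (compatible_wp22_wp12 L) (compatible_wp22_wp11 L))
      (Compatible.linear_v C₀ C₁ (compatible_wp12_wp12 L) (compatible_wp12_wp11 L))).congr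
      (isOpen_ellΩ L) (fun _ _ => .rfl) (fun _ _ => .rfl) fun p _ => ?_
    simp only [ellipB2S]
    ring

end Elliptic
end TypeB2

/-! ### The rational families, by direct differentiation. -/

namespace TypeB2
open Set Filter Topology Complex

attribute [fun_prop] analyticAt_fst analyticAt_snd

theorem Compatible.of_hasDerivAt {Ω : Set (ℂ × ℂ)} {uM uP v w uM' uP' v' w' : ℂ → ℂ}
    {T : ℂ → ℂ → ℂ} (uM_an : ∀ x y, (x, y) ∈ Ω → AnalyticAt ℂ uM (x - y))
    (uP_an : ∀ x y, (x, y) ∈ Ω → AnalyticAt ℂ uP (x + y))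
    (v_an : ∀ x y, (x, y) ∈ Ω → AnalyticAt ℂ v x) (w_an : ∀ x y, (x, y) ∈ Ω → AnalyticAt ℂ w y)
    (T_an : AnalyticOnNhd ℂ (fun p : ℂ × ℂ => T p.1 p.2) Ω)
    (huM : ∀ x y, (x, y) ∈ Ω → HasDerivAt uM (uM' (x - y)) (x - y))
    (huP : ∀ x y, (x, y) ∈ Ω → HasDerivAt uP (uP' (x + y)) (x + y))
    (hv : ∀ x y, (x, y) ∈ Ω → HasDerivAt v (v' x) x)
    (hw : ∀ x y, (x, y) ∈ Ω → HasDerivAt w (w' y) y)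
    (T_x : ∀ x y, (x, y) ∈ Ω → HasDerivAt (fun s => T s y)
      (4 * w y * (uP' (x + y) + uM' (x - y)) - 2 * w' y * (uM (x - y) - uP (x + y))) x)
    (T_y : ∀ x y, (x, y) ∈ Ω → HasDerivAt (fun s => T x s)
      (4 * v x * (uP' (x + y) - uM' (x - y)) - 2 * v' x * (uM (x - y) - uP (x + y))) y) :
    Compatible Ω uM uP v w T where
  uM_an p hp := uM_an _ _ hp
  uP_an p hp := uP_an _ _ hp
  v_an p hp := v_an _ _ hp
  w_an p hp := w_an _ _ hp
  T_an := T_an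
  T_x p hp := by
    rw [(T_x _ _ hp).deriv, (huM _ _ hp).deriv, (huP _ _ hp).deriv, (hw _ _ hp).deriv]
  T_y p hp := by
    rw [(T_y _ _ hp).deriv, (huM _ _ hp).deriv, (huP _ _ hp).deriv, (hv _ _ hp).deriv]

section Rational

theorem hasDerivAt_quadratic (a b : ℂ) {t : ℂ} (ht : t ≠ 0) :
    HasDerivAt (fun t => a / t ^ 2 + b * t ^ 2) (-2 * a / t ^ 3 + 2 * b * t) t := by
  have h2 := hasDerivAt_pow 2 t
  convert! ((hasDerivAt_const t a).div h2 (pow_ne_zero 2 ht)).add (h2.const_mul b) using 1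
  push_cast
  field_simp
  ring

theorem hasDerivAt_inv_sq (a : ℂ) {t : ℂ} (ht : t ≠ 0) :
    HasDerivAt (fun t => a / t ^ 2) (-2 * a / t ^ 3) t := by
  simpa using hasDerivAt_quadratic a 0 ht

theorem isCommuting_ratB2S (A₀ A₁ C₀ C₁ : ℂ) : (ratB2S A₀ A₁ C₀ C₁).IsCommuting := by
  refine System.isCommuting_of_compatible _ ?_ (fun x y _ => ?_) ?_
  · exact (isOpen_ne_fun (by fun_prop) (by fun_prop)).inter
      ((isOpen_ne_fun (by fun_prop) (by fun_prop)).inter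
      ((isOpen_ne_fun (by fun_prop) (by fun_prop)).inter
        (isOpen_ne_fun (by fun_prop) (by fun_prop))))
  · simp only [ratB2S]; ring
  · have hsq : ∀ x y : ℂ, x - y ≠ 0 → x + y ≠ 0 → x ^ 2 - y ^ 2 ≠ 0 := fun x y h1 h2 => by
      rw [sq_sub_sq]; exact mul_ne_zero h2 h1
    refine Compatible.of_hasDerivAt (uM' := fun t => -2 * A₀ / t ^ 3 + 2 * A₁ * t)
      (uP' := fun t => -2 * A₀ / t ^ 3 + 2 * A₁ * t) (v' := fun t => -2 * C₀ / t ^ 3 + 2 * C₁ * t)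
      (w' := fun t => -2 * C₀ / t ^ 3 + 2 * C₁ * t) ?_ ?_ ?_ ?_ ?_ ?_ ?_ ?_ ?_ ?_ ?_
    · rintro x y ⟨h1, h2, h3, h4⟩
      simp only at h1 h2 h3 h4
      simp only [ratB2S]
      fun_prop (disch := simpa)
    · rintro x y ⟨h1, h2, h3, h4⟩
      simp only at h1 h2 h3 h4
      simp only [ratB2S]
      fun_prop (disch := simpa)
    · rintro x y ⟨h1, h2, h3, h4⟩
      simp only at h1 h2 h3 h4
      simp only [ratB2S]
      fun_prop (disch := simpa)
    · rintro x y ⟨h1, h2, h3, h4⟩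
      simp only at h1 h2 h3 h4
      simp only [ratB2S]
      fun_prop (disch := simpa)
    · rintro ⟨x, y⟩ ⟨h1, h2, h3, h4⟩
      have := pow_ne_zero 2 (hsq x y h1 h2)
      simp only [ratB2S]
      fun_prop (disch := simpa)
    · exact fun x y h => hasDerivAt_quadratic _ _ h.1
    · exact fun x y h => hasDerivAt_quadratic _ _ h.2.1
    · exact fun x y h => hasDerivAt_quadratic _ _ h.2.2.1
    · exact fun x y h => hasDerivAt_quadratic _ _ h.2.2.2
    · rintro x y ⟨h1, h2, h3, h4⟩
      simp only at h1 h2 h3 h4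
      have h5 := hsq x y h1 h2
      have hx := hasDerivAt_pow 2 x
      have d1 := ((((hx.const_mul (16 * A₀ * C₁)).mul_const (y ^ 2)).const_add (16 * A₀ * C₀)).div
        ((hx.sub_const (y ^ 2)).pow 2) (pow_ne_zero 2 h5)).add
        ((hx.const_mul (16 * A₁ * C₁)).mul_const (y ^ 2))
      simp only [ratB2S]
      convert! d1 using 1
      simp only [Pi.pow_apply, sq_sub_sq, Nat.cast_ofNat]
      field_simp
      ring
    · rintro x y ⟨h1, h2, h3, h4⟩
      simp only at h1 h2 h3 h4
      have h5 := hsq x y h1 h2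
      have hy := hasDerivAt_pow 2 y
      have d1 := (((hy.const_mul (16 * A₀ * C₁ * x ^ 2)).const_add (16 * A₀ * C₀)).div
        ((hy.const_sub (x ^ 2)).pow 2) (pow_ne_zero 2 h5)).add
        (hy.const_mul (16 * A₁ * C₁ * x ^ 2))
      simp only [ratB2S]
      convert! d1 using 1
      simp only [Pi.pow_apply, sq_sub_sq, Nat.cast_ofNat]
      field_simp
      ring

theorem isCommuting_ratDualD2SBry (A₀ A₁ C₀ C₁ : ℂ) :
    (ratDualD2SBry A₀ A₁ C₀ C₁).IsCommuting := by
  refine System.isCommuting_of_compatible _ ?_ (fun x y _ => ?_) ?_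
  · exact (isOpen_ne_fun (by fun_prop) (by fun_prop)).inter
        (isOpen_ne_fun (by fun_prop) (by fun_prop))
  · simp only [ratDualD2SBry]; ring
  · have hu : ∀ t : ℂ, HasDerivAt (fun t => A₀ * t ^ 2 + A₁ * t ^ 4)
        (2 * A₀ * t + 4 * A₁ * t ^ 3) t := fun t => by
      convert! ((hasDerivAt_pow 2 t).const_mul A₀).add ((hasDerivAt_pow 4 t).const_mul A₁) using 1
      push_cast
      ring
    refine Compatible.of_hasDerivAt (uM' := fun t => 2 * A₀ * t + 4 * A₁ * t ^ 3)
      (uP' := fun t => 2 * A₀ * t + 4 * A₁ * t ^ 3) (v' := fun t => -2 * C₀ / t ^ 3)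
      (w' := fun t => -2 * C₁ / t ^ 3) ?_ ?_ ?_ ?_ ?_ (fun _ _ _ => hu _) (fun _ _ _ => hu _)
      (fun _ _ h => hasDerivAt_inv_sq _ h.1) (fun _ _ h => hasDerivAt_inv_sq _ h.2) ?_ ?_
    · rintro x y ⟨h1, h2⟩
      simp only [ratDualD2SBry]
      fun_prop
    · rintro x y ⟨h1, h2⟩
      simp only [ratDualD2SBry]
      fun_prop
    · rintro x y ⟨h1, h2⟩
      simp only [ratDualD2SBry]
      fun_prop (disch := simpa)
    · rintro x y ⟨h1, h2⟩
      simp only [ratDualD2SBry]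
      fun_prop (disch := simpa)
    · rintro ⟨x, y⟩ ⟨h1, h2⟩
      simp only [ratDualD2SBry]
      fun_prop
    · rintro x y ⟨h1, h2⟩
      simp only at h1 h2
      simp only [ratDualD2SBry]
      convert! (((hasDerivAt_pow 2 x).const_mul C₁).const_add (C₀ * y ^ 2)).const_mul (32 * A₁)
        using 1
      push_cast
      field_simp
      ring
    · rintro x y ⟨h1, h2⟩
      simp only at h1 h2
      simp only [ratDualD2SBry]
      convert! (((hasDerivAt_pow 2 y).const_mul C₀).add_const (C₁ * x ^ 2)).const_mul (32 * A₁)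
        using 1
      push_cast
      field_simp
      ring

end Rational
end TypeB2

/-! ### The hyperbolic `B₂` family. -/

namespace TypeB2
open Set Filter Topology Complex

section Trigonometric

/-- Hyperbolic functions become rational in a single exponential, so that `field_simp` and `ring`
can decide the identities below. -/
theorem sinh_eq_exp (z : ℂ) : sinh z = (exp z ^ 2 - 1) / (2 * exp z) := by
  have := exp_ne_zero z
  rw [sinh, exp_neg]; field_simp

theorem cosh_eq_exp (z : ℂ) : cosh z = (exp z ^ 2 + 1) / (2 * exp z) := by
  have := exp_ne_zero z
  rw [cosh, exp_neg]; field_simp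

theorem exp_sq_sub_one_ne_zero {z : ℂ} (h : sinh z ≠ 0) : exp z ^ 2 - 1 ≠ 0 := fun h0 =>
  h (by rw [sinh_eq_exp, h0, zero_div])

theorem sinhInvSq_neg (z : ℂ) : sinhInvSq (-z) = sinhInvSq z := by simp [sinhInvSq]

theorem hasDerivAt_exp_mul (k t : ℂ) : HasDerivAt (fun t => exp (k * t)) (k * exp (k * t)) t := by
  convert! ((hasDerivAt_id t).const_mul k).cexp using 1
  simp; ring

theorem hasDerivAt_sinh_mul (k t : ℂ) : HasDerivAt (fun t => sinh (k * t)) (k * cosh (k * t)) t := by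
  convert! ((hasDerivAt_id t).const_mul k).csinh using 1
  simp; ring

theorem hasDerivAt_cosh_mul (k t : ℂ) : HasDerivAt (fun t => cosh (k * t)) (k * sinh (k * t)) t := by
  convert! ((hasDerivAt_id t).const_mul k).ccosh using 1
  simp; ring

theorem hasDerivAt_sinhInvSq_mul (k : ℂ) {t : ℂ} (h : sinh (k * t) ≠ 0) :
    HasDerivAt (fun t => sinhInvSq (k * t)) (-2 * k * cosh (k * t) / sinh (k * t) ^ 3) t := by
  convert! ((hasDerivAt_sinh_mul k t).pow 2).inv (pow_ne_zero 2 h) using 1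
  simp only [Pi.pow_apply, Nat.cast_ofNat, Nat.reduceSub, pow_one]
  field_simp

theorem analyticAt_sinhInvSq_mul (k : ℂ) {t : ℂ} (h : sinh (k * t) ≠ 0) :
    AnalyticAt ℂ (fun t => sinhInvSq (k * t)) t := by
  have := pow_ne_zero 2 h
  have h1 : AnalyticAt ℂ (fun t => sinh (k * t)) t := by fun_prop
  exact (h1.pow 2).inv this

theorem sinh_mul_half_ne_zero {lam t : ℂ} (h : sinh (2 * lam * t) ≠ 0) :
    sinh (lam * t) ≠ 0 ∧ cosh (lam * t) ≠ 0 := by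
  rw [mul_assoc, sinh_two_mul] at h
  exact ⟨fun h0 => h (by simp [h0]), fun h0 => h (by simp [h0])⟩

/-- The analogue of `PeriodPair.addDet_eq_zero` for `sinh⁻²`. In terms of `a = exp (k * x)` and `b =
exp (k * y)` it is an identity of rational functions. -/
theorem sinhInvSq_addition (k : ℂ) {x y : ℂ} (hx : sinh (k * x) ≠ 0) (hy : sinh (k * y) ≠ 0)
    (hxy : sinh (k * (x + y)) ≠ 0) :
    -2 * k * cosh (k * (x + y)) / sinh (k * (x + y)) ^ 3 * (sinhInvSq (k * x) - sinhInvSq (k * y))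
      + sinhInvSq (k * (x + y)) * (-2 * k * cosh (k * x) / sinh (k * x) ^ 3
        - -2 * k * cosh (k * y) / sinh (k * y) ^ 3)
      + sinhInvSq (k * x) * (-2 * k * cosh (k * y) / sinh (k * y) ^ 3)
      - -2 * k * cosh (k * x) / sinh (k * x) ^ 3 * sinhInvSq (k * y) = 0 := by
  have e : exp (k * (x + y)) = exp (k * x) * exp (k * y) := by rw [mul_add, exp_add]
  have h1 := exp_sq_sub_one_ne_zero hx
  have h2 := exp_sq_sub_one_ne_zero hy
  have h3 := exp_sq_sub_one_ne_zero hxy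
  have h4 := exp_ne_zero (k * x)
  have h5 := exp_ne_zero (k * y)
  simp only [sinhInvSq, sinh_eq_exp, cosh_eq_exp]
  rw [e, mul_pow] at h3
  rw [e]
  generalize exp (k * x) = a at *
  generalize exp (k * y) = b at *
  field_simp
  ring

theorem sinh_add_pi_mul_I (z : ℂ) : sinh (z + Real.pi * I) = -sinh z := by
  rw [sinh_add]; simp [sinh_mul_I, cosh_mul_I]

theorem cosh_add_pi_mul_I (z : ℂ) : cosh (z + Real.pi * I) = -cosh z := by
  rw [cosh_add]; simp [sinh_mul_I, cosh_mul_I]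

/-- The trigonometric degeneration of `Compatible.weierstrass`. -/
theorem Compatible.sinhInvSq (k ω : ℂ) (hω : k * (2 * ω) = 0 ∨ k * (2 * ω) = Real.pi * I)
    {Ω : Set (ℂ × ℂ)} (hΩ : ∀ z ∈ Ω, sinh (k * (z.1 - z.2)) ≠ 0 ∧ sinh (k * (z.1 + z.2)) ≠ 0 ∧
      sinh (k * (z.1 + ω)) ≠ 0 ∧ sinh (k * (z.2 + ω)) ≠ 0) (hswap : ∀ z ∈ Ω, z.swap ∈ Ω) :
    Compatible Ω (fun t => TypeB2.sinhInvSq (k * t)) (fun t => TypeB2.sinhInvSq (k * t))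
      (fun t => TypeB2.sinhInvSq (k * (t + ω))) (fun t => TypeB2.sinhInvSq (k * (t + ω)))
      (fun x y => 2 * (TypeB2.sinhInvSq (k * (x - y)) + TypeB2.sinhInvSq (k * (x + y)))
        * (TypeB2.sinhInvSq (k * (x + ω)) + TypeB2.sinhInvSq (k * (y + ω)))
        + -4 * (TypeB2.sinhInvSq (k * (x + ω)) * TypeB2.sinhInvSq (k * (y + ω)))) := by
  -- Translation by `2ω` changes `sinh` and `cosh` by a common sign, which drops out of both
  -- `sinh⁻²` and `cosh / sinh³`.
  have per : ∀ t, (sinh (k * (t + 2 * ω)) = sinh (k * t) ∧ cosh (k * (t + 2 * ω)) = cosh (k * t)) ∨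
      (sinh (k * (t + 2 * ω)) = -sinh (k * t) ∧ cosh (k * (t + 2 * ω)) = -cosh (k * t)) := by
    intro t
    rw [mul_add]
    rcases hω with h | h
    · left; simp [h]
    · right; rw [h]; exact ⟨sinh_add_pi_mul_I _, cosh_add_pi_mul_I _⟩
  refine Compatible.of_addition (S := {t | sinh (k * t) = 0})
    (p := fun t => TypeB2.sinhInvSq (k * t))
    (p' := fun t => -2 * k * cosh (k * t) / sinh (k * t) ^ 3) ω hΩ hswap
    (fun t ht => analyticAt_sinhInvSq_mul k ht) (fun t ht => hasDerivAt_sinhInvSq_mul k ht)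
    (fun t ht h => ht (by simpa using h)) (fun t => by rw [mul_neg, sinhInvSq_neg])
    (fun t => by
      simp only [mul_neg, cosh_neg, sinh_neg, (by decide : Odd 3).neg_pow, div_neg])
    (fun t ht h => ht ?_) (fun t => ?_) (fun t => ?_)
    (fun x y hx hy hxy => sinhInvSq_addition k hx hy hxy)
  · rcases per t with ⟨h1, -⟩ | ⟨h1, -⟩
    · exact h1.symm.trans h
    · exact neg_eq_zero.1 (h1.symm.trans h)
  · rcases per t with ⟨h1, -⟩ | ⟨h1, -⟩ <;> simp [TypeB2.sinhInvSq, h1]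
  · rcases per t with ⟨h1, h2⟩ | ⟨h1, h2⟩ <;>
      simp only [h1, h2, mul_neg, (by decide : Odd 3).neg_pow, div_neg, neg_div, neg_neg]

variable {lam : ℂ}

variable (lam) in
/-- The set on which the trigonometric system is considered. -/
def trigΩ : Set (ℂ × ℂ) := {p | sinh (2 * lam * (p.1 - p.2)) ≠ 0 ∧
  sinh (2 * lam * (p.1 + p.2)) ≠ 0 ∧ sinh (2 * lam * p.1) ≠ 0 ∧ sinh (2 * lam * p.2) ≠ 0}

variable (lam) in
theorem isOpen_trigΩ : IsOpen (trigΩ lam) :=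
  (isOpen_ne_fun (by fun_prop) (by fun_prop)).inter
    ((isOpen_ne_fun (by fun_prop) (by fun_prop)).inter
      ((isOpen_ne_fun (by fun_prop) (by fun_prop)).inter
        (isOpen_ne_fun (by fun_prop) (by fun_prop))))

variable (lam) in
theorem swap_mem_trigΩ : ∀ z ∈ trigΩ lam, z.swap ∈ trigΩ lam := by
  rintro ⟨x, y⟩ ⟨h1, h2, h3, h4⟩
  refine ⟨fun h => h1 ?_, by rwa [add_comm] at h2, h4, h3⟩
  simp only [Prod.fst_swap, Prod.snd_swap] at h ⊢
  rw [← neg_sub, mul_neg, sinh_neg, h, neg_zero]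

/-- From `1 / (4s²c²) = (c² - s²) / (4s²c²)` with `c² - s² = 1`. It replaces the index two relation,
and no additive constant appears. -/
theorem sinhInvSq_two_mul {z : ℂ} (hs : sinh z ≠ 0) (hc : cosh z ≠ 0) :
    sinhInvSq (2 * z) = 1 / 4 * sinhInvSq z + 1 / 4 * -coshInvSq z := by
  simp only [sinhInvSq, coshInvSq, sinh_two_mul]
  field_simp
  linear_combination -4 * cosh_sq z

theorem sinhInvSq_add_quarter (z : ℂ) : sinhInvSq (z + Real.pi / 2 * I) = -coshInvSq z := by
  simp [sinhInvSq, coshInvSq, sinh_add, sinh_mul_I, cosh_mul_I, mul_pow, ← inv_neg]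

variable (lam) in
theorem compatible_trig_half_inv : Compatible (trigΩ lam)
    (fun t => sinhInvSq (lam * t)) (fun t => sinhInvSq (lam * t))
    (fun t => sinhInvSq (2 * lam * t)) (fun t => sinhInvSq (2 * lam * t))
    (fun x y => 2 * (sinhInvSq (lam * (x - y)) + sinhInvSq (lam * (x + y)))
      * (sinhInvSq (2 * lam * x) + sinhInvSq (2 * lam * y))
      - (sinhInvSq (lam * x) * sinhInvSq (lam * y) + coshInvSq (lam * x) * coshInvSq (lam * y))) := by
  -- The half period requires division by `λ`; for `λ = 0` the domain is empty.
  rcases eq_or_ne lam 0 with rfl | hl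
  · have : trigΩ 0 = ∅ := by ext z; simp [trigΩ]
    rw [this]
    constructor <;> intro p hp <;> exact hp.elim
  -- Translation by this half period turns `sinh⁻² λt` into `-cosh⁻² λt`. The signs cancel in the
  -- product entering `T`, and the weights `1/4` turn its factor `-4` into `-1`.
  set ω : ℂ := Real.pi / 2 * I / lam with hω
  have hlω : ∀ t, lam * (t + ω) = lam * t + Real.pi / 2 * I := fun t => by
    rw [hω]; field_simp
  have hcosh : ∀ z, sinh (z + Real.pi / 2 * I) = cosh z * I := fun z => by
    simp [sinh_add, sinh_mul_I, cosh_mul_I]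
  have b0 := Compatible.sinhInvSq lam 0 (Or.inl (by simp)) (Ω := trigΩ lam)
    (fun z hz => ⟨(sinh_mul_half_ne_zero hz.1).1, (sinh_mul_half_ne_zero hz.2.1).1,
      by simpa using (sinh_mul_half_ne_zero hz.2.2.1).1,
      by simpa using (sinh_mul_half_ne_zero hz.2.2.2).1⟩) (swap_mem_trigΩ lam)
  have b1 := Compatible.sinhInvSq lam ω (Or.inr (by rw [hω]; field_simp)) (Ω := trigΩ lam)
    (fun z hz => ⟨(sinh_mul_half_ne_zero hz.1).1, (sinh_mul_half_ne_zero hz.2.1).1,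
      by rw [hlω, hcosh]; exact mul_ne_zero (sinh_mul_half_ne_zero hz.2.2.1).2 I_ne_zero,
      by rw [hlω, hcosh]; exact mul_ne_zero (sinh_mul_half_ne_zero hz.2.2.2).2 I_ne_zero⟩)
    (swap_mem_trigΩ lam)
  simp only [add_zero, hlω, sinhInvSq_add_quarter] at b0 b1
  have hev : ∀ z, sinh (2 * lam * z) ≠ 0 → (fun t => 1 / 4 * sinhInvSq (lam * t)
      + 1 / 4 * -coshInvSq (lam * t)) =ᶠ[𝓝 z] fun t => sinhInvSq (2 * lam * t) := by
    intro z hz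
    have hc : ContinuousAt (fun t => sinh (2 * lam * t)) z := by fun_prop
    filter_upwards [hc.eventually_ne hz] with t ht
    rw [mul_assoc, sinhInvSq_two_mul (sinh_mul_half_ne_zero ht).1 (sinh_mul_half_ne_zero ht).2]
  refine (Compatible.linear_v (1 / 4) (1 / 4) b0 b1).congr (isOpen_trigΩ lam)
    (fun p hp => hev _ hp.2.2.1) (fun p hp => hev _ hp.2.2.2) fun p hp => ?_
  rw [← (hev _ hp.2.2.1).eq_of_nhds, ← (hev _ hp.2.2.2).eq_of_nhds]
  ring

variable (lam) in
theorem compatible_trig_double_inv : Compatible (trigΩ lam)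
    (fun t => sinhInvSq (2 * lam * t)) (fun t => sinhInvSq (2 * lam * t))
    (fun t => sinhInvSq (2 * lam * t)) (fun t => sinhInvSq (2 * lam * t))
    (fun x y => 2 * (sinhInvSq (2 * lam * (x - y)) + sinhInvSq (2 * lam * (x + y)))
      * (sinhInvSq (2 * lam * x) + sinhInvSq (2 * lam * y))
      + -4 * (sinhInvSq (2 * lam * x) * sinhInvSq (2 * lam * y))) := by
  have b0 := Compatible.sinhInvSq (2 * lam) 0 (Or.inl (by simp)) (Ω := trigΩ lam)
    (fun z hz => by simp only [add_zero]; exact hz) (swap_mem_trigΩ lam)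
  simpa only [add_zero] using b0

theorem hasDerivAt_sinh_sq (k t : ℂ) :
    HasDerivAt (fun t => sinh (k * t) ^ 2) (2 * k * sinh (k * t) * cosh (k * t)) t := by
  convert! (hasDerivAt_sinh_mul k t).pow 2 using 1
  push_cast
  ring

/-- Specialises `Compatible.of_symm` to `u = sinh⁻² kt` and an entire `v`, so that only one identity
for `∂F/∂x` is left to check. -/
theorem compatible_trig_sq {k : ℂ} {Ω : Set (ℂ × ℂ)} {v v' : ℂ → ℂ} {F : ℂ → ℂ → ℂ}
    (hΩ : ∀ p ∈ Ω, sinh (k * (p.1 - p.2)) ≠ 0 ∧ sinh (k * (p.1 + p.2)) ≠ 0)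
    (hswap : ∀ p ∈ Ω, p.swap ∈ Ω) (hv : ∀ t, AnalyticAt ℂ v t) (hv' : ∀ t, HasDerivAt v (v' t) t)
    (hF : AnalyticOnNhd ℂ (fun p : ℂ × ℂ => F p.1 p.2) Ω) (hFsymm : ∀ x y, F x y = F y x)
    (hFx : ∀ x y, (x, y) ∈ Ω → deriv (fun s => F s y) x =
      2 * (-2 * k * cosh (k * (x + y)) / sinh (k * (x + y)) ^ 3
        + -2 * k * cosh (k * (x - y)) / sinh (k * (x - y)) ^ 3) * (v y - v x)
        - 2 * (sinhInvSq (k * (x + y)) + sinhInvSq (k * (x - y))) * v' x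
        - 2 * v' y * (sinhInvSq (k * (x - y)) - sinhInvSq (k * (x + y)))) :
    Compatible Ω (fun t => sinhInvSq (k * t)) (fun t => sinhInvSq (k * t)) v v
      (fun x y => 2 * (sinhInvSq (k * (x - y)) + sinhInvSq (k * (x + y))) * (v x + v y)
        + F x y) :=
  Compatible.of_symm (Du := {t | sinh (k * t) ≠ 0}) (Dv := univ)
    (u := fun t => sinhInvSq (k * t))
    (u' := fun t => -2 * k * cosh (k * t) / sinh (k * t) ^ 3) (v' := v')
    (fun p hp => ⟨(hΩ p hp).1, (hΩ p hp).2, trivial, trivial⟩) hswap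
    (fun t ht => analyticAt_sinhInvSq_mul k ht) (fun t _ => hv t)
    (fun t ht => hasDerivAt_sinhInvSq_mul k ht) (fun t _ => hv' t)
    (fun t => by rw [mul_neg, sinhInvSq_neg])
    (fun t => by
      simp only [mul_neg, cosh_neg, sinh_neg, (by decide : Odd 3).neg_pow, div_neg])
    hF hFsymm hFx

variable (lam) in
theorem compatible_trig_double_sq : Compatible (trigΩ lam)
    (fun t => sinhInvSq (2 * lam * t)) (fun t => sinhInvSq (2 * lam * t))
    (fun t => sinh (2 * lam * t) ^ 2) (fun t => sinh (2 * lam * t) ^ 2)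
    (fun x y => 2 * (sinhInvSq (2 * lam * (x - y)) + sinhInvSq (2 * lam * (x + y)))
      * (sinh (2 * lam * x) ^ 2 + sinh (2 * lam * y) ^ 2) + 0) := by
  generalize hk : 2 * lam = k
  refine compatible_trig_sq (F := fun _ _ => 0) (fun p hp => by subst hk; exact ⟨hp.1, hp.2.1⟩)
    (swap_mem_trigΩ lam) (fun t => by fun_prop) (fun t => hasDerivAt_sinh_sq k t)
    (fun _ _ => analyticAt_const) (fun _ _ => rfl) fun x y h => ?_
  obtain ⟨h1, h2, -, -⟩ := h
  simp only [hk] at h1 h2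
  have ep : exp (k * (x + y)) = exp (k * x) * exp (k * y) := by rw [mul_add, exp_add]
  have em : exp (k * (x - y)) = exp (k * x) / exp (k * y) := by rw [mul_sub, exp_sub]
  have hp := exp_sq_sub_one_ne_zero h2
  have hm := exp_sq_sub_one_ne_zero h1
  have ha := exp_ne_zero (k * x)
  have hb := exp_ne_zero (k * y)
  simp only [sinhInvSq, sinh_eq_exp, cosh_eq_exp, deriv_const]
  rw [ep, mul_pow] at hp
  rw [em] at hm
  rw [ep, em]
  generalize exp (k * x) = a at *
  generalize exp (k * y) = b at *
  -- This is `sinh (k * (x - y)) ≠ 0` once `exp (k * (x - y)) = a / b` is cleared of its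
  -- denominator.
  have hm' : a ^ 2 - b ^ 2 ≠ 0 := fun h => hm (by
    rw [div_pow, sub_eq_zero.1 h, div_self (pow_ne_zero 2 hb), sub_self])
  field_simp
  ring

variable (lam) in
theorem compatible_trig_half_sq : Compatible (trigΩ lam)
    (fun t => sinhInvSq (lam * t)) (fun t => sinhInvSq (lam * t))
    (fun t => sinh (2 * lam * t) ^ 2) (fun t => sinh (2 * lam * t) ^ 2)
    (fun x y => 2 * (sinhInvSq (lam * (x - y)) + sinhInvSq (lam * (x + y)))
      * (sinh (2 * lam * x) ^ 2 + sinh (2 * lam * y) ^ 2)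
      + -16 * (sinh (lam * x) ^ 2 + sinh (lam * y) ^ 2
        + 2 * (sinh (lam * x) ^ 2 * sinh (lam * y) ^ 2))) := by
  refine compatible_trig_sq (F := fun x y => -16 * (sinh (lam * x) ^ 2 + sinh (lam * y) ^ 2
        + 2 * (sinh (lam * x) ^ 2 * sinh (lam * y) ^ 2)))
    (fun p hp => ⟨(sinh_mul_half_ne_zero hp.1).1, (sinh_mul_half_ne_zero hp.2.1).1⟩)
    (swap_mem_trigΩ lam) (fun t => by fun_prop) (fun t => hasDerivAt_sinh_sq (2 * lam) t)
    (fun _ _ => by fun_prop) (fun _ _ => by ring) fun x y h => ?_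
  obtain ⟨h1, h2, -, -⟩ := h
  have d := hasDerivAt_sinh_sq lam x
  refine (((d.add_const (sinh (lam * y) ^ 2)).add ((d.mul_const (sinh (lam * y) ^ 2)).const_mul
    2)).const_mul (-16)).deriv.trans ?_
  replace h1 := (sinh_mul_half_ne_zero h1).1
  replace h2 := (sinh_mul_half_ne_zero h2).1
  have ep : exp (lam * (x + y)) = exp (lam * x) * exp (lam * y) := by rw [mul_add, exp_add]
  have em : exp (lam * (x - y)) = exp (lam * x) / exp (lam * y) := by rw [mul_sub, exp_sub]
  have e2 : ∀ t, exp (2 * lam * t) = exp (lam * t) ^ 2 := fun t => by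
    rw [← exp_nat_mul]; push_cast; ring_nf
  have hp := exp_sq_sub_one_ne_zero h2
  have hm := exp_sq_sub_one_ne_zero h1
  have ha := exp_ne_zero (lam * x)
  have hb := exp_ne_zero (lam * y)
  simp only [sinhInvSq, sinh_eq_exp, cosh_eq_exp, e2]
  rw [ep, mul_pow] at hp
  rw [em] at hm
  rw [ep, em]
  generalize exp (lam * x) = a at *
  generalize exp (lam * y) = b at *
  have hm' : a ^ 2 - b ^ 2 ≠ 0 := fun h => hm (by
    rw [div_pow, sub_eq_zero.1 h, div_self (pow_ne_zero 2 hb), sub_self])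
  field_simp
  ring

theorem isCommuting_trigB2S (lam A₀ A₁ C₀ C₁ : ℂ) : (trigB2S lam A₀ A₁ C₀ C₁).IsCommuting := by
  refine System.isCommuting_of_compatible _ (isOpen_trigΩ lam) (fun x y _ => ?_) ?_
  · simp only [trigB2S]; ring
  · refine (Compatible.linear_u A₀ A₁
      (Compatible.linear_v C₀ C₁ (compatible_trig_half_inv lam) (compatible_trig_half_sq lam))
      (Compatible.linear_v C₀ C₁ (compatible_trig_double_inv lam)
        (compatible_trig_double_sq lam))).congr
      (isOpen_trigΩ lam) (fun _ _ => .rfl) (fun _ _ => .rfl) fun p _ => ?_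
    simp only [trigB2S]
    ring

end Trigonometric
end TypeB2

/-! ### The Toda families and the hyperbolic `A₁` family. -/

namespace TypeB2
open Set Filter Topology Complex

section Toda

theorem hasDerivAt_two_exp (A₀ A₁ k l t : ℂ) :
    HasDerivAt (fun t => A₀ * exp (k * t) + A₁ * exp (l * t))
      (A₀ * (k * exp (k * t)) + A₁ * (l * exp (l * t))) t :=
  ((hasDerivAt_exp_mul k t).const_mul A₀).add ((hasDerivAt_exp_mul l t).const_mul A₁)

/-- The `A₀` part contributes nothing to `T`: for `u = e^{-2λt}` the logarithmic derivatives of `v`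
and `w` are `4λ` and `-4λ`, so `4wu' - 2w'u` and `-4vu' - 2v'u` both vanish. -/
theorem isCommuting_todaC2S (lam A₀ A₁ C₀ C₁ : ℂ) : (todaC2S lam A₀ A₁ C₀ C₁).IsCommuting := by
  refine System.isCommuting_of_compatible _ isOpen_univ (fun x y _ => ?_) ?_
  · simp only [todaC2S]; ring
  · refine Compatible.of_hasDerivAt
      (uM' := fun t => A₀ * (-2 * lam * exp (-2 * lam * t)) + A₁ * (-4 * lam * exp (-4 * lam * t)))
      (uP' := fun _ => 0) (v' := fun t => C₀ * (4 * lam * exp (4 * lam * t)))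
      (w' := fun t => C₁ * (-4 * lam * exp (-4 * lam * t)))
      ?_ ?_ ?_ ?_ ?_ (fun x y _ => hasDerivAt_two_exp _ _ _ _ _)
      (fun _ _ _ => hasDerivAt_const _ _) (fun x y _ => (hasDerivAt_exp_mul _ _).const_mul _)
      (fun x y _ => (hasDerivAt_exp_mul _ _).const_mul _) (fun x y _ => ?_) (fun x y _ => ?_)
    · intro x y _; simp only [todaC2S]; fun_prop
    · intro x y _; simp only [todaC2S]; fun_prop
    · intro x y _; simp only [todaC2S]; fun_prop
    · intro x y _; simp only [todaC2S]; fun_prop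
    · intro p _; simp only [todaC2S]; fun_prop
    · simp only [todaC2S]
      convert! (((hasDerivAt_exp_mul (-4 * lam) x).const_mul C₁).const_add
        (C₀ * exp (4 * lam * y))).const_mul (2 * A₁) using 1
      have e1 : exp (-2 * lam * (x - y)) = exp (-2 * lam * x) / exp (-2 * lam * y) := by
        rw [mul_sub, exp_sub]
      have e2 : ∀ t, exp (-4 * lam * t) = exp (-2 * lam * t) ^ 2 := fun t => by
        rw [← exp_nat_mul]; push_cast; ring_nf
      have ha := exp_ne_zero (-2 * lam * x)
      have hb := exp_ne_zero (-2 * lam * y)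
      simp only [e2, e1]
      field_simp
      ring
    · simp only [todaC2S]
      convert! (((hasDerivAt_exp_mul (4 * lam) y).const_mul C₀).add_const
        (C₁ * exp (-4 * lam * x))).const_mul (2 * A₁) using 1
      have e1 : exp (-2 * lam * (x - y)) = exp (-2 * lam * x) / exp (-2 * lam * y) := by
        rw [mul_sub, exp_sub]
      have e2 : ∀ t, exp (-4 * lam * t) = exp (-2 * lam * t) ^ 2 := fun t => by
        rw [← exp_nat_mul]; push_cast; ring_nf
      have e4 : ∀ t, exp (4 * lam * t) = (exp (-2 * lam * t) ^ 2)⁻¹ := fun t => by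
        rw [← exp_nat_mul, ← exp_neg]; push_cast; ring_nf
      have ha := exp_ne_zero (-2 * lam * x)
      have hb := exp_ne_zero (-2 * lam * y)
      simp only [e2, e1, e4]
      field_simp
      ring

theorem isCommuting_todaB2SBry (lam A₀ A₁ C₀ C₁ : ℂ) :
    (todaB2SBry lam A₀ A₁ C₀ C₁).IsCommuting := by
  refine System.isCommuting_of_compatible _ (isOpen_ne_fun (by fun_prop) (by fun_prop))
    (fun x y _ => ?_) ?_
  · simp only [todaB2SBry]; ring
  · refine Compatible.of_hasDerivAt
      (uM' := fun t => A₀ * (-2 * lam * exp (-2 * lam * t)) + A₁ * (-4 * lam * exp (-4 * lam * t)))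
      (uP' := fun t => A₀ * (-2 * lam * exp (-2 * lam * t)) + A₁ * (-4 * lam * exp (-4 * lam * t)))
      (v' := fun t => C₀ * (4 * lam * exp (4 * lam * t)))
      (w' := fun t => C₁ * (-2 * (2 * lam) * cosh (2 * lam * t) / sinh (2 * lam * t) ^ 3))
      ?_ ?_ ?_ (fun x y h => analyticAt_const.mul (analyticAt_sinhInvSq_mul _ h)) ?_
      (fun x y _ => hasDerivAt_two_exp _ _ _ _ _) (fun x y _ => hasDerivAt_two_exp _ _ _ _ _)
      (fun x y _ => (hasDerivAt_exp_mul _ _).const_mul _)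
      (fun x y h => (hasDerivAt_sinhInvSq_mul _ h).const_mul _) (fun x y h => ?_)
      (fun x y h => ?_)
    · intro x y _; simp only [todaB2SBry]; fun_prop
    · intro x y _; simp only [todaB2SBry]; fun_prop
    · intro x y _; simp only [todaB2SBry]; fun_prop
    · intro p _; simp only [todaB2SBry]; fun_prop
    all_goals
      replace h : sinh (2 * lam * y) ≠ 0 := h
      have em : exp (-2 * lam * (x - y)) = exp (2 * lam * y) / exp (2 * lam * x) := by
        rw [← exp_sub]; ring_nf
      have ep : exp (-2 * lam * (x + y)) = (exp (2 * lam * x) * exp (2 * lam * y))⁻¹ := by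
        rw [← exp_add, ← exp_neg]; ring_nf
      have e2 : ∀ t, exp (-4 * lam * t) = exp (-2 * lam * t) ^ 2 := fun t => by
        rw [← exp_nat_mul]; push_cast; ring_nf
      have e3 : exp (-2 * lam * x) = (exp (2 * lam * x))⁻¹ := by rw [← exp_neg]; ring_nf
      have e4 : ∀ t, exp (4 * lam * t) = exp (2 * lam * t) ^ 2 := fun t => by
        rw [← exp_nat_mul]; push_cast; ring_nf
      have hb' := exp_sq_sub_one_ne_zero h
      have ha := exp_ne_zero (2 * lam * x)
      have hb := exp_ne_zero (2 * lam * y)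
    · simp only [todaB2SBry]
      convert! (((hasDerivAt_exp_mul (-4 * lam) x).const_mul (2 * C₁)).const_add
        (C₀ * cosh (4 * lam * y))).const_mul (4 * A₁) using 1
      simp only [sinhInvSq, sinh_eq_exp, cosh_eq_exp, e2, em, ep, e3]
      generalize exp (2 * lam * x) = a at *
      generalize exp (2 * lam * y) = b at *
      field_simp
      ring
    · simp only [todaB2SBry]
      convert! (((hasDerivAt_cosh_mul (4 * lam) y).const_mul C₀).add_const
        (2 * C₁ * exp (-4 * lam * x))).const_mul (4 * A₁) using 1
      simp only [sinh_eq_exp, e2, e4, em, ep]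
      generalize exp (2 * lam * x) = a at *
      generalize exp (2 * lam * y) = b at *
      field_simp
      ring

theorem hasDerivAt_two_cosh (A₀ A₁ k l t : ℂ) :
    HasDerivAt (fun t => A₀ * cosh (k * t) + A₁ * cosh (l * t))
      (A₀ * (k * sinh (k * t)) + A₁ * (l * sinh (l * t))) t :=
  ((hasDerivAt_cosh_mul k t).const_mul A₀).add ((hasDerivAt_cosh_mul l t).const_mul A₁)

theorem isCommuting_todaD2SBry (lam A₀ A₁ C₀ C₁ : ℂ) :
    (todaD2SBry lam A₀ A₁ C₀ C₁).IsCommuting := by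
  refine System.isCommuting_of_compatible _ ((isOpen_ne_fun (by fun_prop) (by fun_prop)).inter
    (isOpen_ne_fun (by fun_prop) (by fun_prop))) (fun x y _ => ?_) ?_
  · simp only [todaD2SBry]; ring
  · refine Compatible.of_hasDerivAt
      (uM' := fun t => A₀ * (2 * lam * sinh (2 * lam * t)) + A₁ * (4 * lam * sinh (4 * lam * t)))
      (uP' := fun t => A₀ * (2 * lam * sinh (2 * lam * t)) + A₁ * (4 * lam * sinh (4 * lam * t)))
      (v' := fun t => C₀ * (-2 * (2 * lam) * cosh (2 * lam * t) / sinh (2 * lam * t) ^ 3))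
      (w' := fun t => C₁ * (-2 * (2 * lam) * cosh (2 * lam * t) / sinh (2 * lam * t) ^ 3))
      ?_ ?_ (fun x y h => analyticAt_const.mul (analyticAt_sinhInvSq_mul _ h.1))
      (fun x y h => analyticAt_const.mul (analyticAt_sinhInvSq_mul _ h.2)) ?_
      (fun x y _ => hasDerivAt_two_cosh _ _ _ _ _) (fun x y _ => hasDerivAt_two_cosh _ _ _ _ _)
      (fun x y h => (hasDerivAt_sinhInvSq_mul _ h.1).const_mul _)
      (fun x y h => (hasDerivAt_sinhInvSq_mul _ h.2).const_mul _) (fun x y h => ?_)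
      (fun x y h => ?_)
    · intro x y _; simp only [todaD2SBry]; fun_prop
    · intro x y _; simp only [todaD2SBry]; fun_prop
    · intro p _; simp only [todaD2SBry]; fun_prop
    all_goals
      have h1 : sinh (2 * lam * x) ≠ 0 := h.1
      have h2 : sinh (2 * lam * y) ≠ 0 := h.2
      have em : exp (2 * lam * (x - y)) = exp (2 * lam * x) / exp (2 * lam * y) := by
        rw [← exp_sub]; ring_nf
      have ep : exp (2 * lam * (x + y)) = exp (2 * lam * x) * exp (2 * lam * y) := by
        rw [← exp_add]; ring_nf
      have e4 : ∀ t, exp (4 * lam * t) = exp (2 * lam * t) ^ 2 := fun t => by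
        rw [← exp_nat_mul]; push_cast; ring_nf
      have ha' := exp_sq_sub_one_ne_zero h1
      have hb' := exp_sq_sub_one_ne_zero h2
      have ha := exp_ne_zero (2 * lam * x)
      have hb := exp_ne_zero (2 * lam * y)
      simp only [todaD2SBry]
    · convert! (((hasDerivAt_cosh_mul (4 * lam) x).const_mul C₁).const_add
        (C₀ * cosh (4 * lam * y))).const_mul (8 * A₁) using 1
      simp only [sinhInvSq, sinh_eq_exp, cosh_eq_exp, e4, em, ep]
      generalize exp (2 * lam * x) = a at *
      generalize exp (2 * lam * y) = b at *
      field_simp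
      ring
    · convert! (((hasDerivAt_cosh_mul (4 * lam) y).const_mul C₀).add_const
        (C₁ * cosh (4 * lam * x))).const_mul (8 * A₁) using 1
      simp only [sinhInvSq, sinh_eq_exp, cosh_eq_exp, e4, em, ep]
      generalize exp (2 * lam * x) = a at *
      generalize exp (2 * lam * y) = b at *
      field_simp
      ring

/-- The potentials `u⁻ = sinh⁻² k t`, `u⁺ = 0` with exponential `v = w`. -/
theorem compatible_sinhInvSq_exp {Ω : Set (ℂ × ℂ)} {k : ℂ}
    (hΩ : ∀ p ∈ Ω, sinh (k * (p.1 - p.2)) ≠ 0) (G G' : ℂ → ℂ → ℂ)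
    (hG : ∀ p, AnalyticAt ℂ (fun p : ℂ × ℂ => G p.1 p.2) p)
    (hGs : ∀ x y, G x y = G y x) (hGx : ∀ x y, HasDerivAt (fun s => G s y) (G' x y) x)
    (v v' : ℂ → ℂ) (hv : ∀ t, AnalyticAt ℂ v t) (hv' : ∀ t, HasDerivAt v (v' t) t)
    (key : ∀ x y, sinh (k * (x - y)) ≠ 0 →
      -2 * k * cosh (k * (x - y)) * G x y + sinh (k * (x - y)) * G' x y =
      -8 * k * v y * cosh (k * (x - y)) - 2 * v' y * sinh (k * (x - y))) :
    Compatible Ω (fun t => sinhInvSq (k * t)) (fun _ => 0) v v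
      (fun x y => sinhInvSq (k * (x - y)) * G x y) := by
  have hTx : ∀ x y, sinh (k * (x - y)) ≠ 0 →
      HasDerivAt (fun s => sinhInvSq (k * (s - y)) * G s y)
        (4 * v y * (-2 * k * cosh (k * (x - y)) / sinh (k * (x - y)) ^ 3)
          - 2 * v' y * sinhInvSq (k * (x - y))) x := by
    intro x y h
    convert! ((hasDerivAt_sinhInvSq_mul k h).comp_sub_const x y).mul (hGx x y) using 1
    simp only [sinhInvSq]
    field_simp
    -- The hypothesis `key` is the equation for `T_x` multiplied by `sinh³`.
    linear_combination -(key x y h)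
  have e : ∀ x y : ℂ, k * (x - y) = -(k * (y - x)) := fun x y => by ring
  refine Compatible.of_hasDerivAt (uM' := fun t => -2 * k * cosh (k * t) / sinh (k * t) ^ 3)
    (uP' := fun _ => 0) (v' := v') (w' := v') (fun x y h => analyticAt_sinhInvSq_mul _ (hΩ (x, y) h))
    (fun _ _ _ => analyticAt_const) (fun _ _ _ => hv _) (fun _ _ _ => hv _) (fun p hp => ?_)
    (fun x y h => hasDerivAt_sinhInvSq_mul _ (hΩ (x, y) h)) (fun _ _ _ => hasDerivAt_const _ _)
    (fun _ _ _ => hv' _) (fun _ _ _ => hv' _) (fun x y h => ?_) (fun x y h => ?_)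
  · exact ((analyticAt_sinhInvSq_mul k (hΩ _ hp)).fun_comp (f := fun p : ℂ × ℂ => p.1 - p.2)
      (analyticAt_fst.sub analyticAt_snd)).mul (hG p)
  · refine (hTx x y (hΩ (x, y) h)).congr_deriv ?_
    ring
  · have h' : sinh (k * (y - x)) ≠ 0 := by
      rw [e, sinh_neg]; exact neg_ne_zero.2 (hΩ (x, y) h)
    -- Evenness of `sinh⁻²` and symmetry of `G` make `T` symmetric, so the `y`-equation reduces to
    -- the `x`-equation at the swapped point.
    have hf : (fun s => sinhInvSq (k * (x - s)) * G x s)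
        = fun s => sinhInvSq (k * (s - x)) * G s x := by
      ext s
      rw [e x s, sinhInvSq_neg, hGs]
    rw [hf]
    refine (hTx y x h').congr_deriv ?_
    rw [e x y, sinhInvSq_neg, cosh_neg, sinh_neg, (by decide : Odd 3).neg_pow, div_neg]
    ring

theorem compatible_trigA1_half (lam C₀ C₁ : ℂ) {Ω : Set (ℂ × ℂ)}
    (hΩ : ∀ p ∈ Ω, sinh (lam * (p.1 - p.2)) ≠ 0) :
    Compatible Ω (fun t => sinhInvSq (lam * t)) (fun _ => 0)
      (fun t => C₀ * exp (-4 * lam * t) + C₁ * exp (4 * lam * t))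
      (fun t => C₀ * exp (-4 * lam * t) + C₁ * exp (4 * lam * t))
      (fun x y => sinhInvSq (lam * (x - y))
        * (4 * (C₀ * exp (-2 * lam * (x + y)) + C₁ * exp (2 * lam * (x + y))))) := by
  refine compatible_sinhInvSq_exp hΩ _
    (fun x y => 4 * (C₀ * (-2 * lam * exp (-2 * lam * (x + y)))
      + C₁ * (2 * lam * exp (2 * lam * (x + y))))) (fun p => by fun_prop)
    (fun x y => by rw [add_comm x]) (fun x y =>
      ((hasDerivAt_two_exp C₀ C₁ _ _ (x + y)).comp_add_const x y).const_mul 4) _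
    _ (fun t => by fun_prop) (fun t => hasDerivAt_two_exp _ _ _ _ _) fun x y h => ?_
  have em : exp (lam * (x - y)) = exp (lam * x) / exp (lam * y) := by
    rw [mul_sub, exp_sub]
  have ep : exp (2 * lam * (x + y)) = (exp (lam * x) * exp (lam * y)) ^ 2 := by
    rw [← exp_add, ← exp_nat_mul]; push_cast; ring_nf
  have ep' : exp (-2 * lam * (x + y)) = ((exp (lam * x) * exp (lam * y)) ^ 2)⁻¹ := by
    rw [← ep, ← exp_neg]; ring_nf
  have e4 : exp (4 * lam * y) = exp (lam * y) ^ 4 := by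
    rw [← exp_nat_mul]; push_cast; ring_nf
  have e4' : exp (-4 * lam * y) = (exp (lam * y) ^ 4)⁻¹ := by
    rw [← e4, ← exp_neg]; ring_nf
  have ha := exp_ne_zero (lam * x)
  have hb := exp_ne_zero (lam * y)
  simp only [sinh_eq_exp, cosh_eq_exp, em, ep, ep', e4, e4']
  generalize exp (lam * x) = a at *
  generalize exp (lam * y) = b at *
  field_simp
  ring

theorem compatible_trigA1_double (lam C₀ C₁ : ℂ) {Ω : Set (ℂ × ℂ)}
    (hΩ : ∀ p ∈ Ω, sinh (2 * lam * (p.1 - p.2)) ≠ 0) :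
    Compatible Ω (fun t => sinhInvSq (2 * lam * t)) (fun _ => 0)
      (fun t => C₀ * exp (-4 * lam * t) + C₁ * exp (4 * lam * t))
      (fun t => C₀ * exp (-4 * lam * t) + C₁ * exp (4 * lam * t))
      (fun x y => sinhInvSq (2 * lam * (x - y))
        * (2 * ((C₀ * exp (-4 * lam * x) + C₁ * exp (4 * lam * x))
          + (C₀ * exp (-4 * lam * y) + C₁ * exp (4 * lam * y))))) := by
  refine compatible_sinhInvSq_exp hΩ _
    (fun x y => 2 * (C₀ * (-4 * lam * exp (-4 * lam * x)) + C₁ * (4 * lam * exp (4 * lam * x))))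
    (fun p => by fun_prop) (fun x y => by rw [add_comm (C₀ * _ + _)]) (fun x y =>
      ((hasDerivAt_two_exp C₀ C₁ _ _ x).add_const _).const_mul 2) _
    _ (fun t => by fun_prop) (fun t => hasDerivAt_two_exp _ _ _ _ _) fun x y h => ?_
  have em : exp (2 * lam * (x - y)) = exp (2 * lam * x) / exp (2 * lam * y) := by
    rw [mul_sub, exp_sub]
  have e4 : ∀ t, exp (4 * lam * t) = exp (2 * lam * t) ^ 2 := fun t => by
    rw [← exp_nat_mul]; push_cast; ring_nf
  have e4' : ∀ t, exp (-4 * lam * t) = (exp (2 * lam * t) ^ 2)⁻¹ := fun t => by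
    rw [← e4, ← exp_neg]; ring_nf
  have ha := exp_ne_zero (2 * lam * x)
  have hb := exp_ne_zero (2 * lam * y)
  simp only [sinh_eq_exp, cosh_eq_exp, em, e4, e4']
  generalize exp (2 * lam * x) = a at *
  generalize exp (2 * lam * y) = b at *
  field_simp
  ring

theorem isCommuting_trigA1SBry (lam A₀ A₁ C₀ C₁ : ℂ) :
    (trigA1SBry lam A₀ A₁ C₀ C₁).IsCommuting := by
  have hΩ : IsOpen (trigA1SBry lam A₀ A₁ C₀ C₁).Ω :=
    isOpen_ne_fun (by fun_prop) (by fun_prop)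
  refine System.isCommuting_of_compatible _ hΩ (fun x y _ => ?_) ?_
  · simp only [trigA1SBry]; ring
  · have h := Compatible.linear_u (Ω := (trigA1SBry lam A₀ A₁ C₀ C₁).Ω) A₀ A₁
      (compatible_trigA1_half lam C₀ C₁ fun p hp => (sinh_mul_half_ne_zero hp).1)
      (compatible_trigA1_double lam C₀ C₁ fun p hp => hp)
    -- The linear combination yields `u⁺ = A₀ * 0 + A₁ * 0`, which has to be recognised as `0`.
    simp only [mul_zero, add_zero] at h
    refine h.congr hΩ (fun _ _ => .rfl) (fun _ _ => .rfl) fun p _ => ?_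
    simp only [trigA1SBry]
    ring

end Toda
end TypeB2

end

theorem mainTheorem7 (A₀ A₁ C₀ C₁ : ℂ) :
    (∀ L : PeriodPair, (TypeB2.ellipB2S L A₀ A₁ C₀ C₁).IsCommuting) ∧
    (∀ lam : ℂ, (TypeB2.trigB2S lam A₀ A₁ C₀ C₁).IsCommuting) ∧
    (TypeB2.ratB2S A₀ A₁ C₀ C₁).IsCommuting ∧
    (∀ lam : ℂ, (TypeB2.todaD2SBry lam A₀ A₁ C₀ C₁).IsCommuting) ∧
    (∀ lam : ℂ, (TypeB2.todaB2SBry lam A₀ A₁ C₀ C₁).IsCommuting) ∧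
    (∀ lam : ℂ, (TypeB2.todaC2S lam A₀ A₁ C₀ C₁).IsCommuting) ∧
    (∀ lam : ℂ, (TypeB2.trigA1SBry lam A₀ A₁ C₀ C₁).IsCommuting) ∧
    (TypeB2.ratDualD2SBry A₀ A₁ C₀ C₁).IsCommuting :=
  ⟨fun L => TypeB2.isCommuting_ellipB2S L A₀ A₁ C₀ C₁,
    fun lam => TypeB2.isCommuting_trigB2S lam A₀ A₁ C₀ C₁,
    TypeB2.isCommuting_ratB2S A₀ A₁ C₀ C₁,
    fun lam => TypeB2.isCommuting_todaD2SBry lam A₀ A₁ C₀ C₁,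
    fun lam => TypeB2.isCommuting_todaB2SBry lam A₀ A₁ C₀ C₁,
    fun lam => TypeB2.isCommuting_todaC2S lam A₀ A₁ C₀ C₁,
    fun lam => TypeB2.isCommuting_trigA1SBry lam A₀ A₁ C₀ C₁,
    TypeB2.isCommuting_ratDualD2SBry A₀ A₁ C₀ C₁⟩
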